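/- Let $d\in\mathbb N$, $n,m\ge 1$, and let $\Sigma,S$ be symmetric positive semidefinite $d\times d$ real matrices. One observes two independent samples $X_1,\dots,X_n$ i.i.d. $\mathcal N(\mu,\Sigma)$ and $Y_1,\dots,Y_m$ i.i.d. $\mathcal N(\nu,S)$ in $\mathbb R^d$; write $\mathbb P_{\mu,\nu}$ for their joint law. For $\eta\ge 0$, $\delta\ge 0$ consider testing $H_0(\eta):\|\mu-\nu\|\le\eta$ against $H_1(\eta,\delta):\|\mu-\nu\|>\eta+\delta$, and for $\alpha\in(0,1)$ let $$\delta^*(\alpha,\Sigma,S,\eta)=\inf\Big\{\delta\ge 0:\ \exists \text{ a test } T=T(X,Y)\in\{0,1\}:\ \sup_{\|\mu-\nu\|\le\eta}\mathbb P_{\mu,\nu}(T=1)+\sup_{\|\mu-\nu\|>\eta+\delta}\mathbb P_{\mu,\nu}(T=0)\le\alpha\Big\}$$ (with $\inf\emptyset=+\infty$, and where the test may depend on $\alpha,\Sigma,S,\eta,\delta$). Put $M=\Sigma/n+S/m$, $\sigma=\|M\|_{\mathrm{op}}^{1/2}$, $d_*=\operatorname{Tr}(M^2)/\sigma^4$ (if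 $M=0$ all products with $\sigma$ below are $0$), $u=-\log\alpha+\log 60$; for $\eta=0$ a minimum in which $\sigma/\eta$ appears is read as $d_*^{1/4}$. Upper bound: there is a universal constant $C>0$ such that for all $d,n,m,\Sigma,S,\eta\ge0$ and $\alpha\in(0,1)$ $$\delta^*(\alpha,\Sigma,S,\eta)\le C\,\sigma\sqrt u\,\max\Big(1,\min\Big(d_*^{1/4},\sqrt{d_*u}\,\frac{\sigma}{\eta}\Big)\Big).$$ Lower bound: if $d_*\ge 3$ and $0<\alpha\le 99/100$, then $$\delta^*(\alpha,\Sigma,S,\eta)\ge \sigma\sqrt{\frac{1-\alpha}{48}}\,\max\Big(1,\min\Big(d_*^{1/4},\sqrt{d_*(1-\alpha)}\,\frac{\sigma}{\eta}\Big)\Big),$$ and if $d_*\ge3$ and $\alpha\in(0,1)$ is arbitrary, the same inequality holds with the entry $1$ of the maximum replaced by $\sqrt{1-\alpha}$. -/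

import Mathlib

open MeasureTheory ProbabilityTheory
open scoped ENNReal NNReal

namespace TwoSampleMean

/-- A pair of samples `(x_1, …, x_n)` and `(y_1, …, y_m)` of points of `ℝ^d`. -/
abbrev Samples (d n m : ℕ) : Type :=
  (Fin n → EuclideanSpace ℝ (Fin d)) × (Fin m → EuclideanSpace ℝ (Fin d))

/-- The joint law of two independent samples, the first one i.i.d. `N(μ, Σ)` of size `n`,
the second one i.i.d. `N(ν, S)` of size `m`. -/
noncomputable def law {d : ℕ} (n m : ℕ) (Sig S : Matrix (Fin d) (Fin d) ℝ)
    (μ ν : EuclideanSpace ℝ (Fin d)) : Measure (Samples d n m) :=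
  (Measure.pi fun _ : Fin n => multivariateGaussian μ Sig).prod
    (Measure.pi fun _ : Fin m => multivariateGaussian ν S)

/-- Worst-case type I error of the test `T` (`true` means rejection) over the null hypothesis
`‖μ - ν‖ ≤ η`, the covariances being fixed. -/
noncomputable def typeOneError {d n m : ℕ} (Sig S : Matrix (Fin d) (Fin d) ℝ) (η : ℝ)
    (T : Samples d n m → Bool) : ℝ≥0∞ :=
  ⨆ (μ : EuclideanSpace ℝ (Fin d)) (ν : EuclideanSpace ℝ (Fin d)) (_ : ‖μ - ν‖ ≤ η),
    law n m Sig S μ ν {z | T z = true}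

/-- Worst-case type II error of the test `T` over the alternative `‖μ - ν‖ > η + δ`,
the covariances being fixed. -/
noncomputable def typeTwoError {d n m : ℕ} (Sig S : Matrix (Fin d) (Fin d) ℝ) (η δ : ℝ)
    (T : Samples d n m → Bool) : ℝ≥0∞ :=
  ⨆ (μ : EuclideanSpace ℝ (Fin d)) (ν : EuclideanSpace ℝ (Fin d)) (_ : η + δ < ‖μ - ν‖),
    law n m Sig S μ ν {z | T z = false}

/-- The minimum separation distance `δ*(α, Σ, S, η)`: the infimum of the `δ ≥ 0` for which some
(measurable) test has worst-case type I and type II errors with sum at most `α`.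
It is an extended real, `∞` if there is no such `δ`. -/
noncomputable def minSep {d : ℕ} (n m : ℕ) (α : ℝ) (Sig S : Matrix (Fin d) (Fin d) ℝ) (η : ℝ) :
    ℝ≥0∞ :=
  ⨅ (δ : ℝ≥0) (_ : ∃ T : Samples d n m → Bool, Measurable T ∧
    typeOneError Sig S η T + typeTwoError Sig S η δ T ≤ ENNReal.ofReal α), (δ : ℝ≥0∞)

/-- `M = Σ/n + S/m`. -/
noncomputable def pooledCov {d : ℕ} (n m : ℕ) (Sig S : Matrix (Fin d) (Fin d) ℝ) :
    Matrix (Fin d) (Fin d) ℝ :=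
  (n : ℝ)⁻¹ • Sig + (m : ℝ)⁻¹ • S

/-- The operator norm of a matrix for the Euclidean norm. -/
noncomputable def opNorm {d : ℕ} (A : Matrix (Fin d) (Fin d) ℝ) : ℝ :=
  ‖Matrix.toEuclideanCLM (𝕜 := ℝ) A‖

/-- `σ`, the square root of the operator norm of `M = Σ/n + S/m`. -/
noncomputable def sigma {d : ℕ} (n m : ℕ) (Sig S : Matrix (Fin d) (Fin d) ℝ) : ℝ :=
  Real.sqrt (opNorm (pooledCov n m Sig S))

/-- The effective dimension `d_* = Tr(M²) / σ⁴`. -/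
noncomputable def effDim {d : ℕ} (n m : ℕ) (Sig S : Matrix (Fin d) (Fin d) ℝ) : ℝ :=
  (pooledCov n m Sig S * pooledCov n m Sig S).trace / sigma n m Sig S ^ 4

/-- `min (D^{1/4}, √(D v) · s / η)`, where the second term counts as `+∞` when `η = 0`. -/
noncomputable def rateMin (s D v η : ℝ) : ℝ :=
  if η = 0 then D ^ (1 / 4 : ℝ) else min (D ^ (1 / 4 : ℝ)) (Real.sqrt (D * v) * (s / η))

end TwoSampleMean

/-! Write `θ = μ - ν`, `a = σ²`, `F² = Tr(M²) = d_* a²`. Characteristic functions show that the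
difference of the empirical means is `N(θ, M)`, that is `θ + ∑ √sᵢ gᵢ eᵢ` in an eigenbasis of `M`.
No covariance is ever inverted, so singular ones need no separate treatment.

Upper bound: the squared norm of this vector is `‖θ‖² + Tr M` plus a Gaussian term of size
`‖θ‖√(au)` and a centred chi-square term of size `uF`. Thresholding it separates the hypotheses once
`δ ≳ √(au)` and `(δ + 2η)δ ≳ uF`. The second condition holds if `δ ≳ √(uF)` or `δ ≳ uF/η`, which
gives the minimum in the rate (`minSep_le_of_separated`).

Lower bound: by Cameron–Martin (`law_shift`), likelihood ratios satisfy `E[L_w L_w'] = exp⟨w, M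
w'⟩`, and a chi-square form of Le Cam's method applies (`one_sub_lt_risk_of_prior`). The null point
is `η` times a leading eigenvector. A shift along that vector gives the entry `1` or `√(1-α)` of the
maximum. Random signs on the other eigenvectors move `‖θ‖²` to `η² + R` at chi-square cost about
`R²/F²`, and `R > 2ηδ + δ²` reproduces the minimum. -/

open scoped RealInnerProductSpace

/-! ### Densities of product and image measures -/

section Density

theorem lintegral_pi_prod_eq_prod {ι : Type*} [Fintype ι] {X : ι → Type*}
    [∀ i, MeasurableSpace (X i)] (μ : ∀ i, Measure (X i)) [∀ i, IsProbabilityMeasure (μ i)]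
    {f : ∀ i, X i → ℝ≥0∞} (hf : ∀ i, Measurable (f i)) :
    ∫⁻ x, ∏ i, f i (x i) ∂(Measure.pi μ) = ∏ i, ∫⁻ x, f i x ∂(μ i) := by
  have h := lintegral_prod_eq_prod_lintegral_of_indepFun (μ := Measure.pi μ) Finset.univ
    (fun i x => f i (x i)) (iIndepFun_pi fun i => (hf i).aemeasurable)
    (fun i => (hf i).comp (measurable_pi_apply i))
  rw [h]
  refine Finset.prod_congr rfl fun i _ => ?_
  have hm := (measurePreserving_eval μ i)
  rw [← hm.map_eq, lintegral_map (hf i) (measurable_pi_apply i)]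

theorem pi_withDensity {ι : Type*} [Fintype ι] {X : ι → Type*}
    [∀ i, MeasurableSpace (X i)] (μ : ∀ i, Measure (X i)) [∀ i, IsProbabilityMeasure (μ i)]
    {f : ∀ i, X i → ℝ≥0∞} (hf : ∀ i, Measurable (f i))
    [∀ i, IsProbabilityMeasure ((μ i).withDensity (f i))] :
    Measure.pi (fun i => (μ i).withDensity (f i)) =
      (Measure.pi μ).withDensity fun x => ∏ i, f i (x i) := by
  refine Measure.pi_eq fun s hs => ?_
  rw [withDensity_apply _ (MeasurableSet.univ_pi hs), ← lintegral_indicator (.univ_pi hs)]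
  have : (Set.univ.pi s).indicator (fun x => ∏ i, f i (x i)) =
      fun x => ∏ i, (s i).indicator (f i) (x i) := by
    ext x
    classical
    by_cases hx : x ∈ Set.univ.pi s
    · rw [Set.indicator_of_mem hx]
      exact Finset.prod_congr rfl fun i _ => (Set.indicator_of_mem (hx i trivial) _).symm
    · rw [Set.indicator_of_notMem hx]
      simp only [Set.mem_pi, Set.mem_univ, true_implies, not_forall] at hx
      obtain ⟨i, hi⟩ := hx
      exact (Finset.prod_eq_zero (Finset.mem_univ i) (Set.indicator_of_notMem hi _)).symm
  rw [this, lintegral_pi_prod_eq_prod μ fun i => (hf i).indicator (hs i)]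
  refine Finset.prod_congr rfl fun i _ => ?_
  rw [lintegral_indicator (hs i), withDensity_apply _ (hs i)]

/-- Carries Cameron–Martin from standard Gaussian coordinates to their affine image. -/
theorem map_withDensity_comp {X Y : Type*} [MeasurableSpace X] [MeasurableSpace Y]
    (μ : Measure X) {φ : X → Y} (hφ : Measurable φ) {f : Y → ℝ≥0∞} (hf : Measurable f) :
    (μ.withDensity (f ∘ φ)).map φ = (μ.map φ).withDensity f := by
  ext s hs
  rw [Measure.map_apply hφ hs, withDensity_apply _ (hφ hs), withDensity_apply _ hs,
    setLIntegral_map hs hf hφ]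
  rfl

end Density

/-! ### Gaussian coordinates and the Cameron–Martin formula -/

section CameronMartin

theorem gaussianReal_eq_withDensity (a : ℝ) :
    gaussianReal a 1 =
      (gaussianReal 0 1).withDensity fun x => ENNReal.ofReal (Real.exp (a * x - a ^ 2 / 2)) := by
  rw [gaussianReal_of_var_ne_zero _ one_ne_zero, gaussianReal_of_var_ne_zero _ one_ne_zero,
    ← withDensity_mul _ (measurable_gaussianPDF _ _) (by fun_prop)]
  congr 1
  ext x
  simp only [Pi.mul_apply, gaussianPDF, gaussianPDFReal]
  rw [← ENNReal.ofReal_mul (by positivity), mul_assoc _ (Real.exp _), ← Real.exp_add]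
  congr 3
  simp
  ring

theorem pi_gaussianReal_eq_withDensity {ι : Type*} [Fintype ι] (a : ι → ℝ) :
    Measure.pi (fun i => gaussianReal (a i) 1) =
      (Measure.pi fun _ : ι => gaussianReal 0 1).withDensity
        fun x => ENNReal.ofReal (Real.exp (∑ i, (a i * x i - a i ^ 2 / 2))) := by
  have h : ∀ i, IsProbabilityMeasure ((gaussianReal 0 1).withDensity
      fun x => ENNReal.ofReal (Real.exp (a i * x - a i ^ 2 / 2))) := fun i => by
    rw [← gaussianReal_eq_withDensity]; infer_instance
  simp_rw [gaussianReal_eq_withDensity (a _)]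
  rw [pi_withDensity (fun _ => gaussianReal 0 1) (fun i => by fun_prop)]
  congr 1
  ext x
  rw [Real.exp_sum, ENNReal.ofReal_prod_of_nonneg fun _ _ => (Real.exp_pos _).le]

variable {d : ℕ}

/-- The affine parametrisation `g ↦ μ + ∑ √sᵢ gᵢ eᵢ`. -/
noncomputable def gaussianParam (e : OrthonormalBasis (Fin d) ℝ (EuclideanSpace ℝ (Fin d)))
    (s : Fin d → ℝ) (μ : EuclideanSpace ℝ (Fin d)) (g : Fin d → ℝ) : EuclideanSpace ℝ (Fin d) :=
  μ + ∑ i, (Real.sqrt (s i) * g i) • e i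

@[fun_prop]
theorem measurable_gaussianParam (e : OrthonormalBasis (Fin d) ℝ (EuclideanSpace ℝ (Fin d)))
    (s : Fin d → ℝ) (μ : EuclideanSpace ℝ (Fin d)) : Measurable (gaussianParam e s μ) := by
  unfold gaussianParam
  fun_prop

theorem inner_gaussianParam (e : OrthonormalBasis (Fin d) ℝ (EuclideanSpace ℝ (Fin d)))
    (s : Fin d → ℝ) (μ t : EuclideanSpace ℝ (Fin d)) (g : Fin d → ℝ) :
    ⟪gaussianParam e s μ g, t⟫ = ⟪μ, t⟫ + ∑ i, Real.sqrt (s i) * g i * ⟪e i, t⟫ := by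
  simp [gaussianParam, inner_add_left, sum_inner, real_inner_smul_left]

theorem inner_apply_eq_sum {A : EuclideanSpace ℝ (Fin d) →L[ℝ] EuclideanSpace ℝ (Fin d)}
    {e : OrthonormalBasis (Fin d) ℝ (EuclideanSpace ℝ (Fin d))} {s : Fin d → ℝ}
    (he : ∀ i, A (e i) = s i • e i) (x y : EuclideanSpace ℝ (Fin d)) :
    ⟪x, A y⟫ = ∑ i, s i * ⟪e i, x⟫ * ⟪e i, y⟫ := by
  conv_lhs => rw [← e.sum_repr' y]
  simp only [map_sum, map_smul, he, inner_sum, inner_smul_right]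
  refine Finset.sum_congr rfl fun i _ => ?_
  rw [real_inner_comm x (e i)]
  ring

/-- Both characteristic functions factor over the eigenbasis, which also covers degenerate `S`. -/
theorem multivariateGaussian_eq_map {S : Matrix (Fin d) (Fin d) ℝ} (hS : S.PosSemidef)
    {e : OrthonormalBasis (Fin d) ℝ (EuclideanSpace ℝ (Fin d))} {s : Fin d → ℝ}
    (he : ∀ i, Matrix.toEuclideanCLM (𝕜 := ℝ) S (e i) = s i • e i) (hs : ∀ i, 0 ≤ s i)
    (μ : EuclideanSpace ℝ (Fin d)) :
    multivariateGaussian μ S =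
      (Measure.pi fun _ => gaussianReal 0 1).map (gaussianParam e s μ) := by
  have : IsProbabilityMeasure ((Measure.pi fun _ : Fin d => gaussianReal 0 1).map
      (gaussianParam e s μ)) := Measure.isProbabilityMeasure_map (by fun_prop)
  apply Measure.ext_of_charFun
  ext t
  rw [charFun_multivariateGaussian hS, charFun_apply, integral_map (by fun_prop) (by fun_prop)]
  simp_rw [inner_gaussianParam, Complex.ofReal_add, add_mul, Complex.exp_add, Complex.ofReal_sum,
    Finset.sum_mul, Complex.exp_sum]
  rw [integral_const_mul, integral_fintype_prod_eq_prod (𝕜 := ℂ)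
    (f := fun i (x : ℝ) => Complex.exp (((√(s i) * x * ⟪e i, t⟫ : ℝ) : ℂ) * Complex.I))]
  have h1 : ∀ i, ∫ x : ℝ, Complex.exp (((√(s i) * x * ⟪e i, t⟫ : ℝ) : ℂ) * Complex.I)
      ∂gaussianReal 0 1 = Complex.exp (-((s i * ⟪e i, t⟫ * ⟪e i, t⟫ : ℝ) : ℂ) / 2) := by
    intro i
    have := charFun_gaussianReal (μ := 0) (v := 1) (√(s i) * ⟪e i, t⟫)
    rw [charFun_apply_real] at this
    rw [show (s i * ⟪e i, t⟫ * ⟪e i, t⟫ : ℝ) = (√(s i) * ⟪e i, t⟫) ^ 2 by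
      rw [mul_pow, Real.sq_sqrt (hs i)]; ring]
    convert this using 1
    · congr 1; ext x; congr 2; push_cast; ring
    · congr 1; push_cast; ring
  simp_rw [h1]
  rw [← Complex.exp_sum, ← Finset.sum_div, Finset.sum_neg_distrib, ← Complex.ofReal_sum,
    ← inner_apply_eq_sum he, Matrix.inner_toEuclideanCLM, real_inner_comm, ← Complex.exp_add]
  congr 1
  ring

/-- The shift stays in the range of `S`, which gives absolute continuity even when `S` is singular.
In coordinates it translates `gᵢ` by `√sᵢ ⟪eᵢ, w⟫`. -/
theorem multivariateGaussian_shift {S : Matrix (Fin d) (Fin d) ℝ} (hS : S.PosSemidef)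
    {e : OrthonormalBasis (Fin d) ℝ (EuclideanSpace ℝ (Fin d))} {s : Fin d → ℝ}
    (he : ∀ i, Matrix.toEuclideanCLM (𝕜 := ℝ) S (e i) = s i • e i) (hs : ∀ i, 0 ≤ s i)
    (μ w : EuclideanSpace ℝ (Fin d)) :
    multivariateGaussian (μ + Matrix.toEuclideanCLM (𝕜 := ℝ) S w) S =
      (multivariateGaussian μ S).withDensity fun x => ENNReal.ofReal
        (Real.exp (⟪x - μ, w⟫ - ⟪w, Matrix.toEuclideanCLM (𝕜 := ℝ) S w⟫ / 2)) := by
  rw [multivariateGaussian_eq_map hS he hs, multivariateGaussian_eq_map hS he hs,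
    ← map_withDensity_comp _ (by fun_prop) (by fun_prop)]
  have h1 : ((fun x => ENNReal.ofReal
        (Real.exp (⟪x - μ, w⟫ - ⟪w, Matrix.toEuclideanCLM (𝕜 := ℝ) S w⟫ / 2))) ∘
          gaussianParam e s μ) = fun x : Fin d → ℝ => ENNReal.ofReal
          (Real.exp (∑ i, (√(s i) * ⟪e i, w⟫ * x i - (√(s i) * ⟪e i, w⟫) ^ 2 / 2))) := by
    ext g
    simp only [Function.comp, inner_sub_left, inner_gaussianParam, inner_apply_eq_sum he,
      Finset.sum_sub_distrib, Finset.sum_div]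
    congr 2
    rw [add_sub_cancel_left]
    congr 1
    · exact Finset.sum_congr rfl fun i _ => by ring
    · refine Finset.sum_congr rfl fun i _ => ?_
      rw [mul_pow, Real.sq_sqrt (hs i)]; ring
  rw [h1, ← pi_gaussianReal_eq_withDensity]
  have h2 : gaussianParam e s (μ + Matrix.toEuclideanCLM (𝕜 := ℝ) S w) =
      gaussianParam e s μ ∘ fun g i => √(s i) * ⟪e i, w⟫ + g i := by
    ext1 g
    simp only [gaussianParam, Function.comp, mul_add, add_smul, Finset.sum_add_distrib, add_assoc]
    congr 2
    conv_lhs => rw [← e.sum_repr' w]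
    simp only [map_sum, map_smul, he]
    refine Finset.sum_congr rfl fun i _ => ?_
    rw [smul_smul, ← mul_assoc, Real.mul_self_sqrt (hs i), mul_comm]
  rw [h2, ← Measure.map_map (by fun_prop) (by fun_prop),
    Measure.pi_map_pi (f := fun i x => √(s i) * ⟪e i, w⟫ + x) (by fun_prop)]
  simp_rw [gaussianReal_map_const_add, zero_add]

end CameronMartin

/-! ### Trace and operator norm through eigenvalues -/

section Spectral

variable {d : ℕ}

theorem norm_sq_apply_eq_sum {A : EuclideanSpace ℝ (Fin d) →L[ℝ] EuclideanSpace ℝ (Fin d)}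
    {e : OrthonormalBasis (Fin d) ℝ (EuclideanSpace ℝ (Fin d))} {s : Fin d → ℝ}
    (he : ∀ i, A (e i) = s i • e i) (x : EuclideanSpace ℝ (Fin d)) :
    ‖A x‖ ^ 2 = ∑ i, s i ^ 2 * ⟪e i, x⟫ ^ 2 := by
  have h : A x = ∑ i, (s i * ⟪e i, x⟫) • e i := by
    conv_lhs => rw [← e.sum_repr' x]
    simp only [map_sum, map_smul, he, smul_smul, mul_comm]
  rw [h, ← e.sum_sq_inner_right]
  refine Finset.sum_congr rfl fun i _ => ?_
  rw [e.orthonormal.inner_right_fintype]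
  ring

theorem trace_eq_sum_inner_toEuclideanCLM
    (e : OrthonormalBasis (Fin d) ℝ (EuclideanSpace ℝ (Fin d))) (M : Matrix (Fin d) (Fin d) ℝ) :
    M.trace = ∑ i, ⟪e i, Matrix.toEuclideanCLM (𝕜 := ℝ) M (e i)⟫ := by
  refine Eq.trans ?_ (LinearMap.trace_eq_sum_inner (Matrix.toEuclideanLin M) e)
  rw [Matrix.toEuclideanLin_eq_toLin_orthonormal, Matrix.trace_toLin_eq]

/-- Eigenbasis and eigenvalues of a positive semidefinite matrix. -/
theorem exists_eigenbasis {M : Matrix (Fin d) (Fin d) ℝ} (hM : M.PosSemidef) :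
    ∃ (e : OrthonormalBasis (Fin d) ℝ (EuclideanSpace ℝ (Fin d))) (s : Fin d → ℝ),
      (∀ i, Matrix.toEuclideanCLM (𝕜 := ℝ) M (e i) = s i • e i) ∧ ∀ i, 0 ≤ s i := by
  refine ⟨hM.1.eigenvectorBasis, hM.1.eigenvalues, fun i => ?_, hM.eigenvalues_nonneg⟩
  ext j
  exact congrFun (hM.1.mulVec_eigenvectorBasis i) j

variable {M : Matrix (Fin d) (Fin d) ℝ}
  {e : OrthonormalBasis (Fin d) ℝ (EuclideanSpace ℝ (Fin d))} {s : Fin d → ℝ}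

theorem trace_mul_self_eq_sum
    (he : ∀ i, Matrix.toEuclideanCLM (𝕜 := ℝ) M (e i) = s i • e i) :
    (M * M).trace = ∑ i, s i ^ 2 := by
  rw [trace_eq_sum_inner_toEuclideanCLM e]
  refine Finset.sum_congr rfl fun i _ => ?_
  rw [map_mul, ContinuousLinearMap.mul_def, ContinuousLinearMap.comp_apply, he, map_smul, he, inner_smul_right, inner_smul_right,
    real_inner_self_eq_norm_sq, e.norm_eq_one]
  ring

theorem eigenvalue_le_opNorm
    (he : ∀ i, Matrix.toEuclideanCLM (𝕜 := ℝ) M (e i) = s i • e i) (i : Fin d) :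
    s i ≤ TwoSampleMean.opNorm M := by
  have h := (Matrix.toEuclideanCLM (𝕜 := ℝ) M).le_opNorm (e i)
  rw [he, norm_smul, e.norm_eq_one, mul_one, mul_one] at h
  exact (le_abs_self _).trans h

theorem exists_eigenvalue_eq_opNorm
    (he : ∀ i, Matrix.toEuclideanCLM (𝕜 := ℝ) M (e i) = s i • e i) (hs : ∀ i, 0 ≤ s i)
    (hpos : 0 < TwoSampleMean.opNorm M) : ∃ i, s i = TwoSampleMean.opNorm M := by
  rcases isEmpty_or_nonempty (Fin d) with hd | hd
  · have : Matrix.toEuclideanCLM (𝕜 := ℝ) M = 0 := by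
      ext x i
      exact hd.elim i
    simp [TwoSampleMean.opNorm, this] at hpos
  obtain ⟨i, hi⟩ := Finite.exists_max s
  refine ⟨i, le_antisymm (eigenvalue_le_opNorm he i) ?_⟩
  refine ContinuousLinearMap.opNorm_le_bound _ (hs i) fun x => ?_
  refine le_of_sq_le_sq ?_ (mul_nonneg (hs i) (norm_nonneg _))
  rw [norm_sq_apply_eq_sum he, mul_pow, ← e.sum_sq_inner_right, Finset.mul_sum]
  gcongr with j
  · exact hs j
  · exact hi j

end Spectral

/-! ### Mean shifts of the two-sample law -/

namespace TwoSampleMean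

variable {d n m : ℕ} {Sig S : Matrix (Fin d) (Fin d) ℝ}

theorem posSemidef_pooledCov (n m : ℕ) (hSig : Sig.PosSemidef) (hS : S.PosSemidef) :
    (pooledCov n m Sig S).PosSemidef :=
  (hSig.smul (by positivity)).add (hS.smul (by positivity))

instance (μ ν : EuclideanSpace ℝ (Fin d)) : IsProbabilityMeasure (law n m Sig S μ ν) := by
  unfold law; infer_instance

/-- The difference of the empirical means. -/
noncomputable def meanDiff (z : Samples d n m) : EuclideanSpace ℝ (Fin d) :=
  (n : ℝ)⁻¹ • ∑ i, z.1 i - (m : ℝ)⁻¹ • ∑ j, z.2 j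

@[fun_prop]
theorem measurable_meanDiff : Measurable (meanDiff : Samples d n m → _) := by
  unfold meanDiff
  fun_prop

theorem inner_pooledCov (x y : EuclideanSpace ℝ (Fin d)) :
    ⟪x, Matrix.toEuclideanCLM (𝕜 := ℝ) (pooledCov n m Sig S) y⟫ =
      (n : ℝ)⁻¹ * ⟪x, Matrix.toEuclideanCLM (𝕜 := ℝ) Sig y⟫ +
        (m : ℝ)⁻¹ * ⟪x, Matrix.toEuclideanCLM (𝕜 := ℝ) S y⟫ := by
  simp [pooledCov, inner_add_right, inner_smul_right]

theorem pi_multivariateGaussian_shift (n : ℕ) (hS : S.PosSemidef)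
    (μ w : EuclideanSpace ℝ (Fin d)) :
    Measure.pi (fun _ : Fin n =>
        multivariateGaussian (μ + Matrix.toEuclideanCLM (𝕜 := ℝ) S w) S) =
      (Measure.pi fun _ : Fin n => multivariateGaussian μ S).withDensity fun x => ENNReal.ofReal
        (Real.exp (⟪∑ i, x i - (n : ℝ) • μ, w⟫ -
          n * ⟪w, Matrix.toEuclideanCLM (𝕜 := ℝ) S w⟫ / 2)) := by
  obtain ⟨e, s, he, hs⟩ := exists_eigenbasis hS
  have hshift := multivariateGaussian_shift hS he hs μ w
  have : IsProbabilityMeasure ((multivariateGaussian μ S).withDensity fun x => ENNReal.ofReal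
        (Real.exp (⟪x - μ, w⟫ - ⟪w, Matrix.toEuclideanCLM (𝕜 := ℝ) S w⟫ / 2))) := by
    rw [← hshift]; infer_instance
  rw [hshift, pi_withDensity (fun _ => multivariateGaussian μ S) (fun i => by fun_prop)]
  congr 1
  ext x
  rw [← ENNReal.ofReal_prod_of_nonneg fun _ _ => (Real.exp_pos _).le, ← Real.exp_sum]
  congr 2
  simp only [inner_sub_left, Finset.sum_sub_distrib, sum_inner, real_inner_smul_left,
    Finset.sum_const, Finset.card_univ, Fintype.card_fin, nsmul_eq_mul]
  ring

/-- The shifts have opposite signs and weights `1/n`, `1/m`, so that the two log-densities combine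
into a function of `meanDiff` alone, with quadratic form `M`. -/
theorem law_shift (hn : 1 ≤ n) (hm : 1 ≤ m) (hSig : Sig.PosSemidef) (hS : S.PosSemidef)
    (μ ν w : EuclideanSpace ℝ (Fin d)) :
    law n m Sig S (μ + Matrix.toEuclideanCLM (𝕜 := ℝ) Sig ((n : ℝ)⁻¹ • w))
        (ν + Matrix.toEuclideanCLM (𝕜 := ℝ) S (-(m : ℝ)⁻¹ • w)) =
      (law n m Sig S μ ν).withDensity fun z => ENNReal.ofReal
        (Real.exp (⟪meanDiff z - (μ - ν), w⟫ -
          ⟪w, Matrix.toEuclideanCLM (𝕜 := ℝ) (pooledCov n m Sig S) w⟫ / 2)) := by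
  have hn' : (n : ℝ) ≠ 0 := by positivity
  have hm' : (m : ℝ) ≠ 0 := by positivity
  unfold law
  rw [pi_multivariateGaussian_shift n hSig, pi_multivariateGaussian_shift m hS,
    prod_withDensity (by fun_prop) (by fun_prop)]
  congr 1
  ext z
  rw [← ENNReal.ofReal_mul (Real.exp_pos _).le, ← Real.exp_add, inner_pooledCov]
  congr 2
  simp only [meanDiff, map_smul, inner_smul_right, inner_sub_left, real_inner_smul_left]
  field_simp
  ring

end TwoSampleMean

/-! ### Le Cam's method with a second-moment bound -/

/-- Chi-square form of Le Cam's lower bound for a null law `P` against a uniform mixture of the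
laws with densities `L k` with respect to `P`. -/
theorem one_sub_lt_risk_of_chiSq {Ω : Type*} [MeasurableSpace Ω] {P : Measure Ω}
    [IsProbabilityMeasure P] {K : Type*} [Fintype K] [Nonempty K] {L : K → Ω → ℝ}
    (hL : ∀ k, Integrable (L k) P) (hL1 : ∀ k, ∫ x, L k x ∂P = 1)
    (hLL : ∀ k l, Integrable (fun x => L k x * L l x) P) {v : ℝ} (hv : 0 < v)
    (hχ : ∑ k, ∑ l, ∫ x, L k x * L l x ∂P < (1 + 3 * v ^ 2) * (Fintype.card K : ℝ) ^ 2)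
    {A : Set Ω} (hA : MeasurableSet A) {R₁ R₂ : ℝ} (h₁ : P.real A ≤ R₁)
    (h₂ : ∀ k, ∫ x in Aᶜ, L k x ∂P ≤ R₂) : 1 - v < R₁ + R₂ := by
  set c : ℝ := (Fintype.card K : ℝ) with hc
  have hcpos : 0 < c := by rw [hc]; exact_mod_cast Fintype.card_pos
  set Q : Ω → ℝ := fun x => c⁻¹ * ∑ k, L k x with hQ
  have hQi : Integrable Q P := (integrable_finsetSum _ fun k _ => hL k).const_mul _
  have hQ1 : ∫ x, Q x ∂P = 1 := by
    simp only [hQ]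
    rw [integral_const_mul, integral_finsetSum _ fun k _ => hL k]
    simp only [hL1, Finset.sum_const, Finset.card_univ, nsmul_eq_mul, mul_one]
    exact inv_mul_cancel₀ hcpos.ne'
  have hQsq : (fun x => Q x ^ 2) = fun x => (c ^ 2)⁻¹ * ∑ k, ∑ l, L k x * L l x := by
    ext x
    simp only [hQ, mul_pow, inv_pow, sq (∑ k, L k x), Finset.sum_mul_sum]
  have hQ2i : Integrable (fun x => Q x ^ 2) P := by
    rw [hQsq]
    exact (integrable_finsetSum _ fun k _ => integrable_finsetSum _ fun l _ => hLL k l).const_mul _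
  have hQ2 : ∫ x, Q x ^ 2 ∂P < 1 + 3 * v ^ 2 := by
    rw [hQsq, integral_const_mul,
      integral_finsetSum _ fun k _ => integrable_finsetSum _ fun l _ => hLL k l]
    simp_rw [integral_finsetSum _ fun l (_ : l ∈ Finset.univ) => hLL _ l]
    rw [inv_mul_lt_iff₀ (by positivity)]
    linarith
  have hQc : ∫ x in Aᶜ, Q x ∂P ≤ R₂ := by
    simp only [hQ]
    rw [integral_const_mul, integral_finsetSum _ fun k _ => (hL k).integrableOn,
      inv_mul_le_iff₀ hcpos]
    calc ∑ k, ∫ x in Aᶜ, L k x ∂P ≤ ∑ _k : K, R₂ := Finset.sum_le_sum fun k _ => h₂ k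
      _ = c * R₂ := by simp [hc]
  clear_value Q
  -- Pointwise `min(1, Q) = (1 + Q)/2 - |Q - 1|/2`, and `|Q - 1| ≤ (Q - 1)²/(2v) + v/2`. Integrating
  -- with `E(Q - 1)² < 3v²` leaves more than `1 - 3v/4 - v/4`.
  have hlow : ∫ x, ((1 + Q x) / 2 - (Q x ^ 2 - 2 * Q x + 1) / (4 * v) - v / 4) ∂P ≤
      ∫ x, (A.indicator (fun _ => (1 : ℝ)) x + Aᶜ.indicator Q x) ∂P := by
    refine integral_mono ?_ ?_ fun x => ?_
    · exact ((((integrable_const _).add hQi).div_const _).sub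
        (((hQ2i.sub (hQi.const_mul 2)).add (integrable_const _)).div_const _)).sub
        (integrable_const _)
    · exact ((integrable_const _).indicator hA).add (hQi.indicator hA.compl)
    · have key : ∀ y : ℝ, (1 + y) / 2 - (y ^ 2 - 2 * y + 1) / (4 * v) - v / 4 ≤ 1 ∧
          (1 + y) / 2 - (y ^ 2 - 2 * y + 1) / (4 * v) - v / 4 ≤ y := by
        intro y
        have e1 : 1 - ((1 + y) / 2 - (y ^ 2 - 2 * y + 1) / (4 * v) - v / 4) =
          (y - 1 - v) ^ 2 / (4 * v) := by field_simp; ring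
        have e2 : y - ((1 + y) / 2 - (y ^ 2 - 2 * y + 1) / (4 * v) - v / 4) =
          (y - 1 + v) ^ 2 / (4 * v) := by field_simp; ring
        have p1 : 0 ≤ (y - 1 - v) ^ 2 / (4 * v) := by positivity
        have p2 : 0 ≤ (y - 1 + v) ^ 2 / (4 * v) := by positivity
        constructor <;> linarith
      by_cases hx : x ∈ A
      · simpa [hx] using (key (Q x)).1
      · simpa [hx] using (key (Q x)).2
  rw [integral_add ((integrable_const _).indicator hA) (hQi.indicator hA.compl),
    integral_indicator hA, integral_indicator hA.compl, setIntegral_const, smul_eq_mul, mul_one,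
    integral_sub (by fun_prop) (by fun_prop), integral_sub (by fun_prop) (by fun_prop),
    integral_div, integral_div, integral_add (by fun_prop) (by fun_prop),
    integral_add (by fun_prop) (by fun_prop), integral_sub (by fun_prop) (by fun_prop),
    integral_const_mul, hQ1] at hlow
  simp only [integral_const, probReal_univ, one_mul, smul_eq_mul, mul_one] at hlow
  have h4 : (∫ x, Q x ^ 2 ∂P - 2 + 1) / (4 * v) < 3 * v / 4 := by
    rw [div_lt_iff₀ (by positivity)]
    nlinarith
  linarith

namespace TwoSampleMean

variable {d n m : ℕ} {Sig S : Matrix (Fin d) (Fin d) ℝ}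

/-- Likelihood ratio of the mean shift in direction `w` with respect to the law whose means differ
by `θ`. -/
noncomputable def likelihood (n m : ℕ) (Sig S : Matrix (Fin d) (Fin d) ℝ)
    (θ w : EuclideanSpace ℝ (Fin d)) (z : Samples d n m) : ℝ :=
  Real.exp (⟪meanDiff z - θ, w⟫ -
    ⟪w, Matrix.toEuclideanCLM (𝕜 := ℝ) (pooledCov n m Sig S) w⟫ / 2)

theorem likelihood_nonneg (θ w : EuclideanSpace ℝ (Fin d)) (z : Samples d n m) :
    0 ≤ likelihood n m Sig S θ w z :=
  (Real.exp_pos _).le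

@[fun_prop]
theorem measurable_likelihood (θ w : EuclideanSpace ℝ (Fin d)) :
    Measurable (likelihood n m Sig S θ w) := by
  unfold likelihood
  fun_prop

theorem lintegral_likelihood (hn : 1 ≤ n) (hm : 1 ≤ m) (hSig : Sig.PosSemidef)
    (hS : S.PosSemidef) (μ ν w : EuclideanSpace ℝ (Fin d)) :
    ∫⁻ z, ENNReal.ofReal (likelihood n m Sig S (μ - ν) w z) ∂law n m Sig S μ ν = 1 := by
  have h := congrArg (fun P : Measure (Samples d n m) => P Set.univ)
    (law_shift hn hm hSig hS μ ν w)
  rw [withDensity_apply _ MeasurableSet.univ, Measure.restrict_univ, measure_univ] at h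
  exact h.symm

theorem integrable_likelihood (hn : 1 ≤ n) (hm : 1 ≤ m) (hSig : Sig.PosSemidef)
    (hS : S.PosSemidef) (μ ν w : EuclideanSpace ℝ (Fin d)) :
    Integrable (likelihood n m Sig S (μ - ν) w) (law n m Sig S μ ν) := by
  refine (lintegral_ofReal_ne_top_iff_integrable (by fun_prop)
    (ae_of_all _ (likelihood_nonneg _ _))).1 ?_
  rw [lintegral_likelihood hn hm hSig hS]
  exact ENNReal.one_ne_top

theorem integral_likelihood (hn : 1 ≤ n) (hm : 1 ≤ m) (hSig : Sig.PosSemidef)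
    (hS : S.PosSemidef) (μ ν w : EuclideanSpace ℝ (Fin d)) :
    ∫ z, likelihood n m Sig S (μ - ν) w z ∂law n m Sig S μ ν = 1 := by
  rw [integral_eq_lintegral_of_nonneg_ae (ae_of_all _ (likelihood_nonneg _ _))
    (by fun_prop), lintegral_likelihood hn hm hSig hS, ENNReal.toReal_one]

/-- Completing the square: the cross term of the quadratic form at `w + w'` is the exponent. As
every likelihood integrates to one, this evaluates the second moments. -/
theorem likelihood_mul (hSig : Sig.PosSemidef) (hS : S.PosSemidef)
    (θ w w' : EuclideanSpace ℝ (Fin d)) (z : Samples d n m) :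
    likelihood n m Sig S θ w z * likelihood n m Sig S θ w' z =
      Real.exp ⟪w, Matrix.toEuclideanCLM (𝕜 := ℝ) (pooledCov n m Sig S) w'⟫ *
        likelihood n m Sig S θ (w + w') z := by
  obtain ⟨e, s, he, -⟩ := exists_eigenbasis (posSemidef_pooledCov n m hSig hS)
  have hsymm : ⟪w', Matrix.toEuclideanCLM (𝕜 := ℝ) (pooledCov n m Sig S) w⟫ =
      ⟪w, Matrix.toEuclideanCLM (𝕜 := ℝ) (pooledCov n m Sig S) w'⟫ := by
    rw [inner_apply_eq_sum he, inner_apply_eq_sum he]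
    exact Finset.sum_congr rfl fun i _ => by ring
  simp only [likelihood, ← Real.exp_add]
  congr 1
  simp only [inner_add_right, inner_add_left, map_add, hsymm]
  ring

theorem pooledCov_apply (w : EuclideanSpace ℝ (Fin d)) :
    Matrix.toEuclideanCLM (𝕜 := ℝ) Sig ((n : ℝ)⁻¹ • w) -
        Matrix.toEuclideanCLM (𝕜 := ℝ) S (-(m : ℝ)⁻¹ • w) =
      Matrix.toEuclideanCLM (𝕜 := ℝ) (pooledCov n m Sig S) w := by
  simp [pooledCov]

/-- All pairs of means are taken as shifts of zero along the directions of `law_shift`. The mean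
difference is then `M w`, and the conditions involve `M` only. -/
theorem one_sub_lt_risk_of_prior (hn : 1 ≤ n) (hm : 1 ≤ m) (hSig : Sig.PosSemidef)
    (hS : S.PosSemidef) {η δ v : ℝ} (hv : 0 < v) (hv1 : v ≤ 1) {T : Samples d n m → Bool}
    (hT : Measurable T) {K : Type*} [Fintype K] [Nonempty K] (w₀ : EuclideanSpace ℝ (Fin d))
    (w : K → EuclideanSpace ℝ (Fin d))
    (h₀ : ‖Matrix.toEuclideanCLM (𝕜 := ℝ) (pooledCov n m Sig S) w₀‖ ≤ η)
    (hw : ∀ k, η + δ < ‖Matrix.toEuclideanCLM (𝕜 := ℝ) (pooledCov n m Sig S) (w₀ + w k)‖)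
    (hχ : ∑ k, ∑ l, Real.exp ⟪w k, Matrix.toEuclideanCLM (𝕜 := ℝ) (pooledCov n m Sig S) (w l)⟫ <
      (1 + 3 * v ^ 2) * (Fintype.card K : ℝ) ^ 2) :
    ENNReal.ofReal (1 - v) < typeOneError Sig S η T + typeTwoError Sig S η δ T := by
  by_contra! hcon
  -- The assumed bound makes both extended errors finite, so they can be compared as reals.
  have hne := ne_top_of_le_ne_top ENNReal.ofReal_ne_top hcon
  obtain ⟨hne₁, hne₂⟩ := ENNReal.add_ne_top.1 hne
  have hle : (typeOneError Sig S η T).toReal + (typeTwoError Sig S η δ T).toReal ≤ 1 - v := by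
    rw [← ENNReal.toReal_add hne₁ hne₂]
    exact ENNReal.toReal_le_of_le_ofReal (by linarith) hcon
  set μ := Matrix.toEuclideanCLM (𝕜 := ℝ) Sig ((n : ℝ)⁻¹ • w₀) with hμ
  set ν := Matrix.toEuclideanCLM (𝕜 := ℝ) S (-(m : ℝ)⁻¹ • w₀) with hν
  have hA : MeasurableSet {z | T z = true} := hT (measurableSet_singleton _)
  refine (one_sub_lt_risk_of_chiSq (P := law n m Sig S μ ν)
    (L := fun k => likelihood n m Sig S (μ - ν) (w k))
    (fun k => integrable_likelihood hn hm hSig hS μ ν _)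
    (fun k => integral_likelihood hn hm hSig hS μ ν _)
    (fun k l => ?_) hv ?_ hA (R₁ := (typeOneError Sig S η T).toReal)
    (R₂ := (typeTwoError Sig S η δ T).toReal) ?_ fun k => ?_).not_ge hle
  · simp_rw [likelihood_mul hSig hS]
    exact (integrable_likelihood hn hm hSig hS μ ν _).const_mul _
  · simp_rw [likelihood_mul hSig hS, integral_const_mul,
      integral_likelihood hn hm hSig hS μ ν, mul_one]
    exact hχ
  · refine ENNReal.toReal_mono hne₁ ?_
    refine le_iSup_of_le μ (le_iSup_of_le ν (le_iSup_of_le ?_ le_rfl))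
    rw [hμ, hν, pooledCov_apply]
    exact h₀
  · rw [integral_eq_lintegral_of_nonneg_ae (ae_of_all _ (likelihood_nonneg _ _))
      (measurable_likelihood _ _).aestronglyMeasurable]
    refine ENNReal.toReal_mono hne₂ ?_
    have h := law_shift hn hm hSig hS μ ν (w k)
    have h' := congrArg (fun P : Measure (Samples d n m) => P {z | T z = true}ᶜ) h
    rw [withDensity_apply _ hA.compl] at h'
    refine h'.symm.le.trans ?_
    refine le_iSup_of_le _ (le_iSup_of_le _ (le_iSup_of_le ?_ (measure_mono fun z hz => ?_)))
    · rw [hμ, hν, ← map_add, ← map_add, ← smul_add, ← smul_add, pooledCov_apply]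
      exact hw k
    · simpa using hz

end TwoSampleMean

/-! ### The two priors and the lower bound -/

/-- The sign `±1` encoded by a Boolean. -/
def boolSign (b : Bool) : ℝ := if b then 1 else -1

theorem boolSign_sq (b : Bool) : boolSign b ^ 2 = 1 := by cases b <;> simp [boolSign]

theorem sum_exp_mul_boolSign (x : ℝ) (b : Bool) :
    ∑ b', Real.exp (x * (boolSign b * boolSign b')) = 2 * Real.cosh x := by
  cases b <;> simp [boolSign, Real.cosh_eq] <;> ring

/-- Second moment of the likelihood ratio of a Rademacher prior. -/
theorem sum_sum_exp_boolSign_le {ι : Type*} [Fintype ι] [DecidableEq ι] (x : ι → ℝ) :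
    ∑ ε : ι → Bool, ∑ ε' : ι → Bool, Real.exp (∑ i, x i * (boolSign (ε i) * boolSign (ε' i))) ≤
      Real.exp ((∑ i, x i ^ 2) / 2) * (Fintype.card (ι → Bool) : ℝ) ^ 2 := by
  have h : ∀ ε : ι → Bool,
      ∑ ε' : ι → Bool, Real.exp (∑ i, x i * (boolSign (ε i) * boolSign (ε' i))) ≤
        Real.exp ((∑ i, x i ^ 2) / 2) * (Fintype.card (ι → Bool) : ℝ) := by
    intro ε
    simp_rw [Real.exp_sum]
    -- For fixed `ε` the sum over `ε'` factors over coordinates into `2 cosh (x i)`, and `cosh x ≤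
    -- exp (x²/2)`.
    rw [← Fintype.prod_sum fun i b => Real.exp (x i * (boolSign (ε i) * boolSign b))]
    simp_rw [sum_exp_mul_boolSign]
    rw [Finset.prod_mul_distrib, Finset.sum_div, Real.exp_sum, mul_comm]
    refine mul_le_mul (Finset.prod_le_prod (fun i _ => (Real.cosh_pos _).le) fun i _ => ?_) ?_
      (by positivity) (Finset.prod_nonneg fun i _ => (Real.exp_pos _).le)
    · exact Real.cosh_le_exp_half_sq _
    · simp
  refine (Finset.sum_le_sum fun ε _ => h ε).trans_eq ?_
  rw [Finset.sum_const, Finset.card_univ, nsmul_eq_mul]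
  ring

theorem exp_lt_one_add {b c : ℝ} (hb : 0 ≤ b) (hb1 : b ≤ 1) (h : b + b ^ 2 < c) :
    Real.exp b < 1 + c := by
  have := (abs_le.1 (Real.abs_exp_sub_one_sub_id_le (x := b) (by rwa [abs_of_nonneg hb]))).2
  linarith

namespace TwoSampleMean

variable {d n m : ℕ} {Sig S : Matrix (Fin d) (Fin d) ℝ}

/-- No test beats a shift along the leading eigenvector. -/
theorem one_sub_lt_risk_of_leading (hn : 1 ≤ n) (hm : 1 ≤ m) (hSig : Sig.PosSemidef)
    (hS : S.PosSemidef) {η δ v b : ℝ} (hη : 0 ≤ η) (hv : 0 < v) (hv1 : v ≤ 1)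
    {T : Samples d n m → Bool} (hT : Measurable T)
    (hpos : 0 < opNorm (pooledCov n m Sig S)) (hδb : δ ^ 2 < opNorm (pooledCov n m Sig S) * b)
    (hb : Real.exp b < 1 + 3 * v ^ 2) :
    ENNReal.ofReal (1 - v) < typeOneError Sig S η T + typeTwoError Sig S η δ T := by
  obtain ⟨e, s, he, hs⟩ := exists_eigenbasis (posSemidef_pooledCov n m hSig hS)
  obtain ⟨i, hi⟩ := exists_eigenvalue_eq_opNorm he hs hpos
  set a := opNorm (pooledCov n m Sig S)
  have hab : 0 ≤ a * b := (sq_nonneg δ).trans hδb.le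
  have hA : ∀ t : ℝ, Matrix.toEuclideanCLM (𝕜 := ℝ) (pooledCov n m Sig S) ((t / a) • e i) =
      t • e i := by
    intro t
    rw [map_smul, he, hi, smul_smul, div_mul_cancel₀ _ hpos.ne']
  -- A one-point prior: `θ` moves from `η e` to `(η + √(ab)) e`, and the second moment is exactly
  -- `exp b`.
  refine one_sub_lt_risk_of_prior hn hm hSig hS hv hv1 hT (K := Unit) ((η / a) • e i)
    (fun _ => (√(a * b) / a) • e i) ?_ (fun _ => ?_) ?_
  · rw [hA, norm_smul, e.norm_eq_one, mul_one, Real.norm_of_nonneg hη]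
  · rw [map_add, hA, hA, ← add_smul, norm_smul, e.norm_eq_one, mul_one,
      Real.norm_of_nonneg (by positivity)]
    gcongr
    exact Real.lt_sqrt_of_sq_lt hδb
  · simp only [Finset.univ_unique, Finset.sum_singleton, hA, Fintype.card_unit, Nat.cast_one,
      one_pow, mul_one]
    rw [inner_smul_left, inner_smul_right, real_inner_self_eq_norm_sq, e.norm_eq_one]
    convert hb using 2
    have : √(a * b) * √(a * b) = a * b := Real.mul_self_sqrt hab
    simp only [conj_trivial]
    field_simp
    linarith

/-- No test beats a random sign perturbation orthogonal to the leading eigenvector. -/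
theorem one_sub_lt_risk_of_signs (hn : 1 ≤ n) (hm : 1 ≤ m) (hSig : Sig.PosSemidef)
    (hS : S.PosSemidef) {η δ v R : ℝ} (hη : 0 ≤ η) (hδ : 0 ≤ δ) (hv : 0 < v) (hv1 : v ≤ 1)
    {T : Samples d n m → Bool} (hT : Measurable T)
    (hpos : 0 < opNorm (pooledCov n m Sig S)) (hR : 2 * η * δ + δ ^ 2 < R) {G : ℝ} (hG : 0 < G)
    (hGtr : G = (pooledCov n m Sig S * pooledCov n m Sig S).trace -
      opNorm (pooledCov n m Sig S) ^ 2)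
    (hRG : Real.exp (R ^ 2 / (2 * G)) < 1 + 3 * v ^ 2) :
    ENNReal.ofReal (1 - v) < typeOneError Sig S η T + typeTwoError Sig S η δ T := by
  obtain ⟨e, s, he, hs⟩ := exists_eigenbasis (posSemidef_pooledCov n m hSig hS)
  obtain ⟨i₀, hi₀⟩ := exists_eigenvalue_eq_opNorm he hs hpos
  rw [trace_mul_self_eq_sum he, ← hi₀] at hGtr
  have hs₀ : 0 < s i₀ := hi₀ ▸ hpos
  have hRpos : 0 < R := lt_of_le_of_lt (by positivity) hR
  have hGsum : ∑ i ∈ Finset.univ.erase i₀, s i ^ 2 = G := by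
    rw [hGtr, ← Finset.add_sum_erase _ _ (Finset.mem_univ i₀)]; ring
  -- Normalised so that the image under `M` has squared norm `R`. By Cauchy–Schwarz, constant
  -- coefficients minimise the cost `∑ sᵢ² cᵢ⁴` under this constraint. The leading coordinate is
  -- left out to keep the perturbation orthogonal to the null point.
  set c : Fin d → ℝ := fun i => if i = i₀ then 0 else √(R / G) with hc
  have hc₀ : c i₀ = 0 := by simp [hc]
  have hc₁ : ∀ i ∈ Finset.univ.erase i₀, c i ^ 2 = R / G := fun i hi => by
    simp only [hc, if_neg (Finset.ne_of_mem_erase hi)]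
    exact Real.sq_sqrt (by positivity)
  set w : (Fin d → Bool) → EuclideanSpace ℝ (Fin d) :=
    fun ε => ∑ i, (c i * boolSign (ε i)) • e i with hw
  have hwi : ∀ ε i, ⟪e i, w ε⟫ = c i * boolSign (ε i) := fun ε i =>
    e.orthonormal.inner_right_fintype _ _
  refine one_sub_lt_risk_of_prior hn hm hSig hS hv hv1 hT ((η / s i₀) • e i₀) w ?_
    (fun ε => ?_) ?_
  · rw [map_smul, he, smul_smul, div_mul_cancel₀ _ hs₀.ne', norm_smul, e.norm_eq_one, mul_one,
      Real.norm_of_nonneg hη]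
  · refine lt_of_pow_lt_pow_left₀ 2 (norm_nonneg _) ?_
    have : ∑ i ∈ Finset.univ.erase i₀, s i ^ 2 * ⟪e i, (η / s i₀) • e i₀ + w ε⟫ ^ 2 = R := by
      have h1 : ∀ i ∈ Finset.univ.erase i₀,
          s i ^ 2 * ⟪e i, (η / s i₀) • e i₀ + w ε⟫ ^ 2 = s i ^ 2 * (R / G) := by
        intro i hi
        rw [inner_add_right, inner_smul_right, hwi,
          e.inner_eq_zero (Finset.ne_of_mem_erase hi), mul_zero, zero_add, mul_pow,
          boolSign_sq, hc₁ i hi, mul_one]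
      rw [Finset.sum_congr rfl h1, ← Finset.sum_mul, hGsum, mul_div_cancel₀ _ hG.ne']
    rw [norm_sq_apply_eq_sum he, ← Finset.add_sum_erase _ _ (Finset.mem_univ i₀), this,
      inner_add_right, inner_smul_right, hwi, hc₀, real_inner_self_eq_norm_sq, e.norm_eq_one]
    have : s i₀ ^ 2 * (η / s i₀ * 1 ^ 2 + 0 * boolSign (ε i₀)) ^ 2 = η ^ 2 := by
      field_simp
      ring
    rw [this]
    linarith
  · have hwM : ∀ ε ε', ⟪w ε, Matrix.toEuclideanCLM (𝕜 := ℝ) (pooledCov n m Sig S) (w ε')⟫ =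
        ∑ i, (s i * c i ^ 2) * (boolSign (ε i) * boolSign (ε' i)) := by
      intro ε ε'
      rw [inner_apply_eq_sum he]
      refine Finset.sum_congr rfl fun i _ => ?_
      rw [hwi, hwi]; ring
    simp_rw [hwM]
    refine (sum_sum_exp_boolSign_le _).trans_lt ?_
    have hsum : ∑ i, (s i * c i ^ 2) ^ 2 = R ^ 2 / G := by
      rw [← Finset.add_sum_erase _ _ (Finset.mem_univ i₀), hc₀]
      have h1 : ∀ i ∈ Finset.univ.erase i₀, (s i * c i ^ 2) ^ 2 = s i ^ 2 * (R / G) ^ 2 := by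
        intro i hi
        rw [hc₁ i hi, mul_pow]
      rw [Finset.sum_congr rfl h1, ← Finset.sum_mul, hGsum]
      field_simp
      ring
    rw [hsum, div_div, mul_comm G]
    gcongr

theorem sigma_sq (n m : ℕ) (Sig S : Matrix (Fin d) (Fin d) ℝ) :
    sigma n m Sig S ^ 2 = opNorm (pooledCov n m Sig S) :=
  Real.sq_sqrt (norm_nonneg _)

theorem trace_eq_effDim_mul (h : sigma n m Sig S ≠ 0) :
    (pooledCov n m Sig S * pooledCov n m Sig S).trace =
      effDim n m Sig S * opNorm (pooledCov n m Sig S) ^ 2 := by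
  rw [effDim, ← sigma_sq]
  field_simp

/-- Division by zero sets `effDim` to `0` when `σ = 0`. -/
theorem sigma_pos_of_effDim (h : 3 ≤ effDim n m Sig S) : 0 < sigma n m Sig S := by
  refine (Real.sqrt_nonneg _).lt_of_ne' fun h0 => ?_
  change sigma n m Sig S = 0 at h0
  rw [effDim, h0] at h
  norm_num at h

theorem rateMin_le_rpow (s D v η : ℝ) : rateMin s D v η ≤ D ^ (1 / 4 : ℝ) := by
  unfold rateMin
  split_ifs
  exacts [le_rfl, min_le_left _ _]

theorem rpow_quarter_sq {D : ℝ} (hD : 0 ≤ D) : (D ^ (1 / 4 : ℝ)) ^ 2 = √D := by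
  rw [Real.sqrt_eq_rpow, ← Real.rpow_natCast, ← Real.rpow_mul hD]
  norm_num

/-- The free factor `r` serves both versions of the bound: `1` for `α ≤ 99/100` and `√(1-α)` in
general. -/
theorem le_of_risk_le_leading (hn : 1 ≤ n) (hm : 1 ≤ m) (hSig : Sig.PosSemidef)
    (hS : S.PosSemidef) {η δ α : ℝ} (hη : 0 ≤ η) (hδ : 0 ≤ δ) (hα : 0 < α) (hα1 : α < 1)
    (hσ : 0 < sigma n m Sig S) {T : Samples d n m → Bool} (hT : Measurable T)
    (hrisk : typeOneError Sig S η T + typeTwoError Sig S η δ T ≤ ENNReal.ofReal α)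
    {r : ℝ} (hr : 0 ≤ r) (hr1 : r ≤ 1)
    (hrv : r ^ 2 * (1 - α) / 48 + (r ^ 2 * (1 - α) / 48) ^ 2 < 3 * (1 - α) ^ 2) :
    sigma n m Sig S * √((1 - α) / 48) * r ≤ δ := by
  by_contra! hlt
  refine absurd hrisk (not_le.2 ?_)
  have hv : 0 < 1 - α := by linarith
  have hpos : 0 < opNorm (pooledCov n m Sig S) := by rw [← sigma_sq]; positivity
  have hr2 : r ^ 2 ≤ 1 := pow_le_one₀ hr hr1
  have h := one_sub_lt_risk_of_leading hn hm hSig hS (δ := δ) (v := 1 - α) (b := r ^ 2 * (1 - α) / 48)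
    hη hv (by linarith) hT hpos ?_ (exp_lt_one_add (by positivity) (by nlinarith) hrv)
  · simpa using h
  · rw [← sigma_sq]
    refine (pow_lt_pow_left₀ hlt hδ two_ne_zero).trans_eq ?_
    rw [mul_pow, mul_pow, Real.sq_sqrt (by positivity)]
    ring

theorem le_of_risk_le_signs (hn : 1 ≤ n) (hm : 1 ≤ m) (hSig : Sig.PosSemidef)
    (hS : S.PosSemidef) {η δ α : ℝ} (hη : 0 ≤ η) (hδ : 0 ≤ δ) (hα : 0 < α) (hα1 : α < 1)
    (hD : 3 ≤ effDim n m Sig S) {T : Samples d n m → Bool} (hT : Measurable T)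
    (hrisk : typeOneError Sig S η T + typeTwoError Sig S η δ T ≤ ENNReal.ofReal α) :
    sigma n m Sig S * √((1 - α) / 48) *
      rateMin (sigma n m Sig S) (effDim n m Sig S) (1 - α) η ≤ δ := by
  by_contra! hlt
  refine absurd hrisk (not_le.2 ?_)
  have hσ := sigma_pos_of_effDim hD
  have hpos : 0 < opNorm (pooledCov n m Sig S) := by rw [← sigma_sq]; positivity
  have htr := trace_eq_effDim_mul hσ.ne'
  have hσ2 := sigma_sq n m Sig S
  set σ := sigma n m Sig S
  set D := effDim n m Sig S
  set a := opNorm (pooledCov n m Sig S)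
  obtain ⟨v, hvdef⟩ : ∃ v, v = 1 - α := ⟨_, rfl⟩
  rw [← hvdef] at hlt
  have hαv : α = 1 - v := by linarith
  have hv : 0 < v := by linarith
  have hv1 : v ≤ 1 := by linarith
  have hDpos : 0 < D := by linarith
  have hsqD : √D ^ 2 = D := Real.sq_sqrt hDpos.le
  have hδ2 : δ ^ 2 < a * √D * v / 48 := by
    have h1 : δ < σ * √(v / 48) * D ^ (1 / 4 : ℝ) :=
      hlt.trans_le (mul_le_mul_of_nonneg_left (rateMin_le_rpow _ _ _ _) (by positivity))
    refine (pow_lt_pow_left₀ h1 hδ two_ne_zero).trans_eq ?_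
    rw [mul_pow, mul_pow, Real.sq_sqrt (by positivity), rpow_quarter_sq hDpos.le, hσ2]
    ring
  have hηδ : 2 * η * δ ≤ 14 / 48 * (a * √D * v) := by
    rcases hη.eq_or_lt with rfl | hη
    · simp only [mul_zero, zero_mul]; positivity
    have h1 : δ ≤ σ * √(v / 48) * (√(D * v) * (σ / η)) := by
      refine hlt.le.trans (mul_le_mul_of_nonneg_left ?_ (by positivity))
      rw [rateMin, if_neg hη.ne']
      exact min_le_right _ _
    -- Since `48 ≤ 7²`. The budget is then `14/48 + 1/48 < 1/3`, the constant chosen in `R`.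
    have h2 : √(v / 48) ≤ 7 / 48 * √v := by
      rw [Real.sqrt_le_left (by positivity), mul_pow, Real.sq_sqrt hv.le]
      linarith
    have h3 : √(D * v) = √D * √v := Real.sqrt_mul hDpos.le _
    have h4 : η * δ ≤ 7 / 48 * (a * √D * v) := by
      calc η * δ ≤ η * (σ * (7 / 48 * √v) * (√D * √v * (σ / η))) := by
            rw [h3] at h1
            gcongr
            exact h1.trans (by gcongr)
        _ = 7 / 48 * (σ ^ 2 * √D * (√v) ^ 2) := by field_simp
        _ = _ := by rw [Real.sq_sqrt hv.le, hσ2]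
    linarith
  -- Here `D ≥ 3` enters: dropping the leading eigenvalue costs at most a third of `Tr(M²)`.
  have hG : 2 / 3 * (a ^ 2 * D) ≤ D * a ^ 2 - a ^ 2 := by nlinarith [sq_nonneg a]
  have haD : 0 < a * √D * v := by positivity
  rw [hαv]
  refine one_sub_lt_risk_of_signs hn hm hSig hS hη hδ hv hv1 hT hpos
    (R := 1 / 3 * (a * √D * v)) (by linarith) (G := D * a ^ 2 - a ^ 2)
    (lt_of_lt_of_le (by positivity) hG) (by rw [htr]) ?_
  have hexp : (1 / 3 * (a * √D * v)) ^ 2 / (2 * (D * a ^ 2 - a ^ 2)) ≤ v ^ 2 / 12 := by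
    rw [div_le_iff₀ (by nlinarith [mul_pos (pow_pos hpos 2) hDpos])]
    have : (1 / 3 * (a * √D * v)) ^ 2 = 1 / 9 * (a ^ 2 * D) * v ^ 2 := by
      rw [mul_pow, mul_pow, mul_pow, hsqD]; ring
    rw [this]
    nlinarith [mul_le_mul_of_nonneg_right hG (sq_nonneg v)]
  refine (Real.exp_le_exp.2 hexp).trans_lt (exp_lt_one_add (by positivity) ?_ ?_)
  · nlinarith
  · nlinarith [pow_pos hv 2, pow_le_one₀ hv.le hv1 (n := 2)]

theorem lower_bound (hn : 1 ≤ n) (hm : 1 ≤ m) (hSig : Sig.PosSemidef)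
    (hS : S.PosSemidef) {η α : ℝ} (hη : 0 ≤ η) (hα : 0 < α) (hα1 : α < 1)
    (hD : 3 ≤ effDim n m Sig S) {r : ℝ} (hr : 0 ≤ r) (hr1 : r ≤ 1)
    (hrv : r ^ 2 * (1 - α) / 48 + (r ^ 2 * (1 - α) / 48) ^ 2 < 3 * (1 - α) ^ 2) :
    ENNReal.ofReal (sigma n m Sig S * √((1 - α) / 48) *
      max r (rateMin (sigma n m Sig S) (effDim n m Sig S) (1 - α) η)) ≤
        minSep n m α Sig S η := by
  refine le_iInf₂ fun δ ⟨T, hT, hrisk⟩ => ?_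
  rw [← ENNReal.ofReal_coe_nnreal]
  refine ENNReal.ofReal_le_ofReal ?_
  have hσ := sigma_pos_of_effDim hD
  rw [mul_max_of_nonneg _ _ (by positivity)]
  exact max_le
    (le_of_risk_le_leading hn hm hSig hS hη δ.2 hα hα1 hσ hT hrisk hr hr1 hrv)
    (le_of_risk_le_signs hn hm hSig hS hη δ.2 hα hα1 hD hT hrisk)

end TwoSampleMean

/-! ### Gaussian and chi-square deviations -/

section Tails

/-- Chernoff bound in terms of a bound on the exponential moment. -/
theorem measureReal_ge_le_of_integral_exp {Ω : Type*} [MeasurableSpace Ω] {P : Measure Ω}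
    [IsFiniteMeasure P] {X : Ω → ℝ} {t l b : ℝ} (ht : 0 ≤ t)
    (hpos : 0 < ∫ x, Real.exp (t * X x) ∂P)
    (hb : ∫ x, Real.exp (t * X x) ∂P ≤ Real.exp b) :
    P.real {x | l ≤ X x} ≤ Real.exp (b - t * l) := by
  -- A non-integrable function has integral `0` by convention, so a positive integral yields
  -- integrability.
  have hint : Integrable (fun x => Real.exp (t * X x)) P := by
    by_contra h
    rw [integral_undef h] at hpos
    exact lt_irrefl _ hpos
  refine (measure_ge_le_exp_mul_mgf l ht hint).trans ?_
  rw [sub_eq_neg_add, Real.exp_add, ← neg_mul]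
  exact mul_le_mul_of_nonneg_left hb (Real.exp_pos _).le

variable {ι : Type*} [Fintype ι]

theorem integral_exp_linear_gaussian (c : ι → ℝ) :
    ∫ g : ι → ℝ, Real.exp (∑ i, c i * g i) ∂(Measure.pi fun _ => gaussianReal 0 1) =
      Real.exp ((∑ i, c i ^ 2) / 2) := by
  simp_rw [Real.exp_sum]
  rw [integral_fintype_prod_eq_prod (𝕜 := ℝ) (f := fun i (x : ℝ) => Real.exp (c i * x)),
    Finset.sum_div, Real.exp_sum]
  refine Finset.prod_congr rfl fun i _ => ?_
  have := congrFun (mgf_fun_id_gaussianReal (μ := 0) (v := 1)) (c i)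
  rw [mgf] at this
  simpa using this

theorem gaussian_linear_tail (c : ι → ℝ) {V u : ℝ} (hc : ∑ i, c i ^ 2 ≤ V) (hu : 0 ≤ u) :
    (Measure.pi fun _ : ι => gaussianReal 0 1).real {g | √(2 * V * u) < ∑ i, c i * g i} ≤
      Real.exp (-u) := by
  have hV0 : 0 ≤ V := (Finset.sum_nonneg fun i _ => sq_nonneg _).trans hc
  -- For `V = 0` the strict inequality in the event matters: it reads `0 < 0`.
  rcases hV0.eq_or_lt with rfl | hV
  · have hz : ∀ i, c i = 0 := fun i => by
      have h := (Finset.sum_eq_zero_iff_of_nonneg fun i _ => sq_nonneg (c i)).1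
        (le_antisymm hc (Finset.sum_nonneg fun i _ => sq_nonneg _)) i (Finset.mem_univ i)
      exact pow_eq_zero_iff two_ne_zero |>.1 h
    simp [hz, (Real.exp_pos _).le]
  set l := √(2 * V * u) with hl
  have hl2 : l ^ 2 = 2 * V * u := Real.sq_sqrt (by positivity)
  have hE : ∫ g : ι → ℝ, Real.exp (l / V * ∑ i, c i * g i) ∂(Measure.pi fun _ => gaussianReal 0 1) =
      Real.exp ((∑ i, (l / V * c i) ^ 2) / 2) := by
    simp_rw [← integral_exp_linear_gaussian, Finset.mul_sum, mul_assoc]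
  refine (measureReal_mono (s₂ := {g : ι → ℝ | l ≤ ∑ i, c i * g i})
    (fun g hg => le_of_lt (α := ℝ) hg) (measure_ne_top _ _)).trans
    ((measureReal_ge_le_of_integral_exp (t := l / V) (b := u) (by positivity)
      (hE ▸ Real.exp_pos _) ?_).trans_eq ?_)
  · rw [hE, Real.exp_le_exp]
    simp_rw [mul_pow]
    rw [← Finset.mul_sum]
    calc (l / V) ^ 2 * (∑ i, c i ^ 2) / 2 ≤ (l / V) ^ 2 * V / 2 := by gcongr
      _ = u := by rw [div_pow, hl2]; field_simp
  · congr 1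
    have : l / V * l = 2 * u := by
      rw [div_mul_eq_mul_div, ← sq, hl2]; field_simp
    linarith

/-- This is `-log (1 - y) ≤ y + y²`; at `y = 2x` it controls the factor `(1 - 2x)^(-1/2)` of the
chi-square exponential moment. -/
theorem one_le_one_sub_mul_exp {y : ℝ} (hy : |y| ≤ 1 / 4) :
    1 ≤ (1 - y) * Real.exp (y + y ^ 2) := by
  obtain ⟨h1, h2⟩ := abs_le.1 hy
  rcases le_total 0 y with h | h
  · have := Real.quadratic_le_exp_of_nonneg (x := y + y ^ 2) (by positivity)
    refine le_trans ?_ (mul_le_mul_of_nonneg_left this (by linarith))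
    have : 0 ≤ y ^ 2 * (1 / 2 - 3 / 2 * y) := by apply mul_nonneg <;> nlinarith
    have : 0 ≤ y ^ 3 * ((1 - y) * (1 + y / 2)) :=
      mul_nonneg (by positivity) (mul_nonneg (by linarith) (by linarith))
    nlinarith
  · have := Real.add_one_le_exp (y + y ^ 2)
    refine le_trans ?_ (mul_le_mul_of_nonneg_left this (by linarith))
    nlinarith [mul_nonneg (neg_nonneg.2 h) (sq_nonneg y)]

theorem integral_exp_sq_gaussianReal {x : ℝ} (hx : x < 1 / 2) :
    ∫ g, Real.exp (x * (g ^ 2 - 1)) ∂gaussianReal 0 1 =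
      Real.exp (-x) * (√(1 - 2 * x))⁻¹ := by
  rw [integral_gaussianReal_eq_integral_smul one_ne_zero]
  have h : ∀ g : ℝ, gaussianPDFReal 0 1 g • Real.exp (x * (g ^ 2 - 1)) =
      (√(2 * Real.pi))⁻¹ * Real.exp (-x) * Real.exp (-(1 / 2 - x) * g ^ 2) := by
    intro g
    simp only [gaussianPDFReal, smul_eq_mul, NNReal.coe_one, mul_one, mul_assoc, ← Real.exp_add]
    congr 2
    ring
  simp_rw [h]
  rw [integral_const_mul, integral_gaussian]
  have : Real.pi / (1 / 2 - x) = 2 * Real.pi * (1 - 2 * x)⁻¹ := by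
    have : 1 - 2 * x ≠ 0 := by linarith
    have : 1 / 2 - x ≠ 0 := by linarith
    field_simp
  rw [this, Real.sqrt_mul (by positivity : 0 ≤ 2 * Real.pi) (1 - 2 * x)⁻¹, Real.sqrt_inv]
  have : √(2 * Real.pi) ≠ 0 := by positivity
  field_simp

theorem integral_exp_sq_gaussianReal_le {x : ℝ} (hx : |x| ≤ 1 / 8) :
    ∫ g, Real.exp (x * (g ^ 2 - 1)) ∂gaussianReal 0 1 ≤ Real.exp (2 * x ^ 2) := by
  obtain ⟨h1, h2⟩ := abs_le.1 hx
  rw [integral_exp_sq_gaussianReal (by linarith)]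
  have hpos : 0 < 1 - 2 * x := by linarith
  have hy : |2 * x| ≤ 1 / 4 := by rw [abs_le]; constructor <;> linarith
  rw [← div_eq_mul_inv, div_le_iff₀ (Real.sqrt_pos.2 hpos)]
  refine le_of_sq_le_sq ?_ (by positivity)
  rw [mul_pow, Real.sq_sqrt hpos.le, ← Real.exp_nat_mul, ← Real.exp_nat_mul]
  have h := mul_le_mul_of_nonneg_right (one_le_one_sub_mul_exp hy) (Real.exp_pos (-(2 * x))).le
  rw [mul_assoc, ← Real.exp_add] at h
  convert h using 1
  · push_cast; ring_nf
  · push_cast; ring_nf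

/-- Chernoff at the fixed parameter `1/(8F)`, where every `|sᵢ|/(8F) ≤ 1/8` and the exponential
moment is at most `exp (1/32) ≤ 2`. The `sᵢ` may have any sign, so lower deviations are covered too.
-/
theorem gaussian_quadratic_tail (s : ι → ℝ) {F u : ℝ} (hF : 0 < F) (hs : ∑ i, s i ^ 2 = F ^ 2) :
    (Measure.pi fun _ : ι => gaussianReal 0 1).real
      {g | 8 * u * F ≤ ∑ i, s i * (g i ^ 2 - 1)} ≤ 2 * Real.exp (-u) := by
  have hE : ∫ g : ι → ℝ, Real.exp (1 / (8 * F) * ∑ i, s i * (g i ^ 2 - 1))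
      ∂(Measure.pi fun _ => gaussianReal 0 1) =
      ∏ i, ∫ x, Real.exp (s i / (8 * F) * (x ^ 2 - 1)) ∂gaussianReal 0 1 := by
    rw [← integral_fintype_prod_eq_prod (𝕜 := ℝ)
      (f := fun i (x : ℝ) => Real.exp (s i / (8 * F) * (x ^ 2 - 1)))]
    congr 1
    ext g
    rw [← Real.exp_sum, Finset.mul_sum]
    congr 1
    exact Finset.sum_congr rfl fun i _ => by ring
  have hsF : ∀ i, |s i / (8 * F)| ≤ 1 / 8 := fun i => by
    have : |s i| ≤ F := by
      refine abs_le_of_sq_le_sq ?_ hF.le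
      rw [← hs]
      exact Finset.single_le_sum (f := fun i => s i ^ 2) (fun i _ => sq_nonneg _)
        (Finset.mem_univ i)
    rw [abs_div, abs_of_pos (by positivity : 0 < 8 * F), div_le_div_iff₀ (by positivity)
      (by norm_num)]
    linarith
  have hpos : ∀ i, 0 < ∫ x, Real.exp (s i / (8 * F) * (x ^ 2 - 1)) ∂gaussianReal 0 1 := fun i => by
    have := (abs_le.1 (hsF i)).2
    rw [integral_exp_sq_gaussianReal (by linarith)]
    have : 0 < √(1 - 2 * (s i / (8 * F))) := Real.sqrt_pos.2 (by linarith)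
    positivity
  refine (measureReal_ge_le_of_integral_exp (t := 1 / (8 * F)) (b := 1 / 32) (by positivity)
    ?_ ?_).trans ?_
  · rw [hE]
    exact Finset.prod_pos fun i _ => hpos i
  · rw [hE]
    refine (Finset.prod_le_prod (fun i _ => (hpos i).le) fun i _ =>
      integral_exp_sq_gaussianReal_le (hsF i)).trans_eq ?_
    rw [← Real.exp_sum]
    congr 1
    simp_rw [div_pow]
    rw [← Finset.mul_sum, ← Finset.sum_div, hs]
    field_simp
    norm_num
  · have h1 : 1 / (8 * F) * (8 * u * F) = u := by field_simp
    rw [h1, sub_eq_add_neg, Real.exp_add]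
    gcongr
    have := (exp_lt_one_add (b := 1 / 32) (c := 1) (by norm_num) (by norm_num) (by norm_num)).le
    linarith

end Tails

/-! ### The norm test and the upper bound -/

namespace TwoSampleMean

variable {d n m : ℕ} {Sig S : Matrix (Fin d) (Fin d) ℝ}

theorem map_meanDiff_law (hn : 1 ≤ n) (hm : 1 ≤ m) (hSig : Sig.PosSemidef) (hS : S.PosSemidef)
    (μ ν : EuclideanSpace ℝ (Fin d)) :
    (law n m Sig S μ ν).map meanDiff = multivariateGaussian (μ - ν) (pooledCov n m Sig S) := by
  have : IsProbabilityMeasure ((law n m Sig S μ ν).map meanDiff) :=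
    Measure.isProbabilityMeasure_map (by fun_prop)
  have hn' : (n : ℂ) ≠ 0 := by exact_mod_cast (show n ≠ 0 by omega)
  have hm' : (m : ℂ) ≠ 0 := by exact_mod_cast (show m ≠ 0 by omega)
  apply Measure.ext_of_charFun
  ext t
  rw [charFun_apply, integral_map (by fun_prop) (by fun_prop),
    charFun_multivariateGaussian (posSemidef_pooledCov n m hSig hS)]
  have h1 : ∀ z : Samples d n m, Complex.exp ((⟪meanDiff z, t⟫ : ℝ) * Complex.I) =
      (∏ i, Complex.exp ((⟪z.1 i, (n : ℝ)⁻¹ • t⟫ : ℝ) * Complex.I)) *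
        ∏ j, Complex.exp ((⟪z.2 j, -(m : ℝ)⁻¹ • t⟫ : ℝ) * Complex.I) := by
    intro z
    rw [← Complex.exp_sum, ← Complex.exp_sum, ← Complex.exp_add]
    congr 1
    simp only [meanDiff, inner_sub_left, real_inner_smul_left, inner_smul_right, sum_inner,
      ← Finset.sum_mul, ← add_mul, ← Complex.ofReal_sum, ← Complex.ofReal_add, ← Finset.mul_sum]
    congr 2
    ring
  simp_rw [h1]
  unfold law
  rw [integral_prod_mul (f := fun x : Fin n → EuclideanSpace ℝ (Fin d) =>
      ∏ i, Complex.exp ((⟪x i, (n : ℝ)⁻¹ • t⟫ : ℝ) * Complex.I))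
    (g := fun y : Fin m → EuclideanSpace ℝ (Fin d) =>
      ∏ j, Complex.exp ((⟪y j, -(m : ℝ)⁻¹ • t⟫ : ℝ) * Complex.I)),
    integral_fintype_prod_eq_prod (𝕜 := ℂ)
      (f := fun _ (x : EuclideanSpace ℝ (Fin d)) =>
        Complex.exp ((⟪x, (n : ℝ)⁻¹ • t⟫ : ℝ) * Complex.I)),
    integral_fintype_prod_eq_prod (𝕜 := ℂ)
      (f := fun _ (x : EuclideanSpace ℝ (Fin d)) =>
        Complex.exp ((⟪x, -(m : ℝ)⁻¹ • t⟫ : ℝ) * Complex.I))]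
  simp_rw [← charFun_apply, charFun_multivariateGaussian hSig, charFun_multivariateGaussian hS,
    ← Matrix.inner_toEuclideanCLM, inner_pooledCov]
  simp only [Finset.prod_const, Finset.card_univ, Fintype.card_fin, ← Complex.exp_nat_mul,
    ← Complex.exp_add]
  congr 1
  simp only [map_smul, inner_smul_right, real_inner_smul_left, inner_sub_right]
  push_cast
  field_simp
  ring

theorem law_preimage_meanDiff (hn : 1 ≤ n) (hm : 1 ≤ m) (hSig : Sig.PosSemidef)
    (hS : S.PosSemidef) {e : OrthonormalBasis (Fin d) ℝ (EuclideanSpace ℝ (Fin d))} {s : Fin d → ℝ}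
    (he : ∀ i, Matrix.toEuclideanCLM (𝕜 := ℝ) (pooledCov n m Sig S) (e i) = s i • e i)
    (hs : ∀ i, 0 ≤ s i) (μ ν : EuclideanSpace ℝ (Fin d)) {B : Set (EuclideanSpace ℝ (Fin d))}
    (hB : MeasurableSet B) :
    law n m Sig S μ ν (meanDiff ⁻¹' B) =
      Measure.pi (fun _ => gaussianReal 0 1) (gaussianParam e s (μ - ν) ⁻¹' B) := by
  rw [← Measure.map_apply (by fun_prop) hB, map_meanDiff_law hn hm hSig hS,
    multivariateGaussian_eq_map (posSemidef_pooledCov n m hSig hS) he hs,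
    Measure.map_apply (by fun_prop) hB]

/-- The test rejecting when the difference of the means falls in `B` bounds the separation. -/
theorem minSep_le_of_region (hn : 1 ≤ n) (hm : 1 ≤ m) (hSig : Sig.PosSemidef)
    (hS : S.PosSemidef) {e : OrthonormalBasis (Fin d) ℝ (EuclideanSpace ℝ (Fin d))} {s : Fin d → ℝ}
    (he : ∀ i, Matrix.toEuclideanCLM (𝕜 := ℝ) (pooledCov n m Sig S) (e i) = s i • e i)
    (hs : ∀ i, 0 ≤ s i) {η α δ p q : ℝ} (hδ : 0 ≤ δ) (hp : 0 ≤ p) (hq : 0 ≤ q) (hpq : p + q ≤ α)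
    {B : Set (EuclideanSpace ℝ (Fin d))} (hB : MeasurableSet B)
    (h₁ : ∀ θ, ‖θ‖ ≤ η →
      (Measure.pi fun _ => gaussianReal 0 1).real (gaussianParam e s θ ⁻¹' B) ≤ p)
    (h₂ : ∀ θ, η + δ < ‖θ‖ →
      (Measure.pi fun _ => gaussianReal 0 1).real (gaussianParam e s θ ⁻¹' Bᶜ) ≤ q) :
    minSep n m α Sig S η ≤ ENNReal.ofReal δ := by
  classical
  refine iInf₂_le (⟨δ, hδ⟩ : ℝ≥0) ⟨fun z => decide (meanDiff z ∈ B), ?_, ?_⟩ |>.trans_eq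
    (ENNReal.ofReal_eq_coe_nnreal hδ).symm
  · refine measurable_to_bool ?_
    convert measurable_meanDiff hB using 1
    ext z
    simp
  · refine le_trans (add_le_add (iSup_le fun μ => iSup_le fun ν => iSup_le fun h => ?_)
      (iSup_le fun μ => iSup_le fun ν => iSup_le fun h => ?_))
      ((ENNReal.ofReal_add hp hq).symm.le.trans (ENNReal.ofReal_le_ofReal hpq))
    · have hset : {z : Samples d n m | decide (meanDiff z ∈ B) = true} = meanDiff ⁻¹' B := by
        ext z; simp
      rw [hset, law_preimage_meanDiff hn hm hSig hS he hs μ ν hB,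
        ← ofReal_measureReal]
      exact ENNReal.ofReal_le_ofReal (h₁ _ h)
    · have hset : {z : Samples d n m | decide (meanDiff z ∈ B) = false} = meanDiff ⁻¹' Bᶜ := by
        ext z; simp
      rw [hset, law_preimage_meanDiff hn hm hSig hS he hs μ ν hB.compl,
        ← ofReal_measureReal]
      exact ENNReal.ofReal_le_ofReal (h₂ _ h)

theorem norm_sq_gaussianParam (e : OrthonormalBasis (Fin d) ℝ (EuclideanSpace ℝ (Fin d)))
    {s : Fin d → ℝ} (hs : ∀ i, 0 ≤ s i) (θ : EuclideanSpace ℝ (Fin d)) (g : Fin d → ℝ) :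
    ‖gaussianParam e s θ g‖ ^ 2 = ‖θ‖ ^ 2 + 2 * ∑ i, (√(s i) * ⟪e i, θ⟫) * g i +
      (∑ i, s i * (g i ^ 2 - 1) + ∑ i, s i) := by
  have h : ∀ i, ⟪e i, gaussianParam e s θ g⟫ = ⟪e i, θ⟫ + √(s i) * g i := by
    intro i
    rw [gaussianParam, inner_add_right, e.orthonormal.inner_right_fintype]
  rw [← e.sum_sq_inner_right, ← e.sum_sq_inner_right θ, Finset.mul_sum, ← Finset.sum_add_distrib,
    ← Finset.sum_add_distrib, ← Finset.sum_add_distrib]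
  refine Finset.sum_congr rfl fun i _ => ?_
  rw [h, add_sq, mul_pow, Real.sq_sqrt (hs i)]
  ring

theorem sum_sq_sqrt_mul_inner_le (e : OrthonormalBasis (Fin d) ℝ (EuclideanSpace ℝ (Fin d)))
    {s : Fin d → ℝ} (hs : ∀ i, 0 ≤ s i) {a : ℝ} (ha : ∀ i, s i ≤ a)
    (θ : EuclideanSpace ℝ (Fin d)) : ∑ i, (√(s i) * ⟪e i, θ⟫) ^ 2 ≤ a * ‖θ‖ ^ 2 := by
  rw [← e.sum_sq_inner_right, Finset.mul_sum]
  refine Finset.sum_le_sum fun i _ => ?_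
  rw [mul_pow, Real.sq_sqrt (hs i)]
  exact mul_le_mul_of_nonneg_right (ha i) (sq_nonneg _)

/-- Upper bound for the separation in terms of the operator and Frobenius norms `a` and `F`. -/
theorem minSep_le_of_separated (hn : 1 ≤ n) (hm : 1 ≤ m) (hSig : Sig.PosSemidef)
    (hS : S.PosSemidef) {e : OrthonormalBasis (Fin d) ℝ (EuclideanSpace ℝ (Fin d))} {s : Fin d → ℝ}
    (he : ∀ i, Matrix.toEuclideanCLM (𝕜 := ℝ) (pooledCov n m Sig S) (e i) = s i • e i)
    (hs : ∀ i, 0 ≤ s i) {η α δ a F u : ℝ} (hδ : 0 ≤ δ) (ha : ∀ i, s i ≤ a)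
    (hF : 0 < F) (hsF : ∑ i, s i ^ 2 = F ^ 2) (hu : 0 ≤ u)
    (hα : 6 * Real.exp (-u) ≤ α)
    (hsep : ∀ r, η + δ < r → 2 * (r + η) * √(2 * a * u) + 16 * u * F ≤ r ^ 2 - η ^ 2) :
    minSep n m α Sig S η ≤ ENNReal.ofReal δ := by
  have hsqrt : ∀ r, 0 ≤ r → √(2 * (a * r ^ 2) * u) = r * √(2 * a * u) := fun r hr => by
    rw [show 2 * (a * r ^ 2) * u = r ^ 2 * (2 * a * u) by ring, Real.sqrt_mul (sq_nonneg r),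
      Real.sqrt_sq hr]
  have hl0 : 0 ≤ √(2 * a * u) := Real.sqrt_nonneg _
  -- Each error costs one linear tail `exp (-u)` and one quadratic tail `2 exp (-u)`. The threshold
  -- is the largest null value of `‖x‖²` off these events.
  refine minSep_le_of_region hn hm hSig hS he hs hδ (p := 3 * Real.exp (-u))
    (q := 3 * Real.exp (-u)) (by positivity) (by positivity) (by linarith)
    (B := {x | ∑ i, s i + η ^ 2 + 2 * η * √(2 * a * u) + 8 * u * F ≤ ‖x‖ ^ 2})
    (measurableSet_le (by fun_prop) (by fun_prop)) (fun θ hθ => ?_) fun θ hθ => ?_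
  · have hlin := gaussian_linear_tail _ (sum_sq_sqrt_mul_inner_le e hs ha θ) hu
    have hquad := gaussian_quadratic_tail s (u := u) hF hsF
    refine (measureReal_mono (s₂ := {g | √(2 * (a * ‖θ‖ ^ 2) * u) <
      ∑ i, (√(s i) * ⟪e i, θ⟫) * g i} ∪ {g | 8 * u * F ≤ ∑ i, s i * (g i ^ 2 - 1)})
      (fun g hg => ?_) (measure_ne_top _ _)).trans ((measureReal_union_le _ _).trans (by linarith))
    simp only [Set.mem_preimage, Set.mem_ofPred_eq, norm_sq_gaussianParam e hs] at hg
    by_contra hcon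
    simp only [Set.mem_union, Set.mem_ofPred_eq, not_or, not_lt, not_le,
      hsqrt _ (norm_nonneg θ)] at hcon
    have h1 : ‖θ‖ ^ 2 ≤ η ^ 2 := pow_le_pow_left₀ (norm_nonneg _) hθ 2
    have h2 : ‖θ‖ * √(2 * a * u) ≤ η * √(2 * a * u) := mul_le_mul_of_nonneg_right hθ hl0
    linarith [hcon.1, hcon.2]
  -- Negated coefficients turn the upper tails into the lower deviations needed under the
  -- alternative.
  · have hlin := gaussian_linear_tail (fun i => -(√(s i) * ⟪e i, θ⟫)) (V := a * ‖θ‖ ^ 2)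
      (by simpa only [neg_sq] using sum_sq_sqrt_mul_inner_le e hs ha θ) hu
    have hquad := gaussian_quadratic_tail (fun i => -s i) (u := u) hF
      (by simpa only [neg_sq] using hsF)
    refine (measureReal_mono (s₂ := {g | √(2 * (a * ‖θ‖ ^ 2) * u) <
      ∑ i, -(√(s i) * ⟪e i, θ⟫) * g i} ∪ {g | 8 * u * F ≤ ∑ i, -s i * (g i ^ 2 - 1)})
      (fun g hg => ?_) (measure_ne_top _ _)).trans ((measureReal_union_le _ _).trans (by linarith))
    simp only [Set.mem_preimage, Set.mem_compl_iff, Set.mem_ofPred_eq, not_le,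
      norm_sq_gaussianParam e hs] at hg
    by_contra hcon
    simp only [Set.mem_union, Set.mem_ofPred_eq, not_or, not_lt, not_le,
      hsqrt _ (norm_nonneg θ), neg_mul, Finset.sum_neg_distrib] at hcon
    have := hsep _ hθ
    linarith [hcon.1, hcon.2]

/-- Without noise the mean difference equals `θ`, and comparing its norm with `η` never errs. -/
theorem minSep_eq_zero_of_sigma_eq_zero (hn : 1 ≤ n) (hm : 1 ≤ m) (hSig : Sig.PosSemidef)
    (hS : S.PosSemidef) {η α : ℝ} (hα : 0 ≤ α) (hσ : sigma n m Sig S = 0) :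
    minSep n m α Sig S η = 0 := by
  obtain ⟨e, s, he, hs⟩ := exists_eigenbasis (posSemidef_pooledCov n m hSig hS)
  have hs0 : ∀ i, s i = 0 := fun i => le_antisymm
    ((eigenvalue_le_opNorm he i).trans_eq (by rw [← sigma_sq, hσ]; norm_num)) (hs i)
  have hG : ∀ θ g, gaussianParam e s θ g = θ := fun θ g => by simp [gaussianParam, hs0]
  rw [← nonpos_iff_eq_zero, ← ENNReal.ofReal_zero]
  refine minSep_le_of_region hn hm hSig hS he hs le_rfl le_rfl le_rfl (by simpa using hα)
    (B := {x | η < ‖x‖}) (measurableSet_lt (by fun_prop) (by fun_prop)) (fun θ hθ => ?_)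
    fun θ hθ => ?_
  · have : gaussianParam e s θ ⁻¹' {x | η < ‖x‖} = ∅ := by
      ext g; simpa [hG] using hθ
    simp [this]
  · have : gaussianParam e s θ ⁻¹' {x | η < ‖x‖}ᶜ = ∅ := by
      ext g; simpa [hG] using hθ
    simp [this]

theorem upper_bound (hn : 1 ≤ n) (hm : 1 ≤ m) (hSig : Sig.PosSemidef)
    (hS : S.PosSemidef) {η α : ℝ} (hη : 0 ≤ η) (hα : 0 < α) (hα1 : α < 1) :
    minSep n m α Sig S η ≤ ENNReal.ofReal
      (16 * (sigma n m Sig S * √(-Real.log α + Real.log 60) *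
        max 1 (rateMin (sigma n m Sig S) (effDim n m Sig S)
          (-Real.log α + Real.log 60) η))) := by
  rcases (Real.sqrt_nonneg _ : 0 ≤ sigma n m Sig S).eq_or_lt with hσ | hσ
  · rw [minSep_eq_zero_of_sigma_eq_zero hn hm hSig hS hα.le hσ.symm]
    exact zero_le
  obtain ⟨e, s, he, hs⟩ := exists_eigenbasis (posSemidef_pooledCov n m hSig hS)
  have hpos : 0 < opNorm (pooledCov n m Sig S) := by rw [← sigma_sq]; positivity
  obtain ⟨i₀, hi₀⟩ := exists_eigenvalue_eq_opNorm he hs hpos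
  have htr := trace_eq_effDim_mul hσ.ne'
  rw [trace_mul_self_eq_sum he] at htr
  have hsa := eigenvalue_le_opNorm he
  have hσ2 := sigma_sq n m Sig S
  set σ := sigma n m Sig S
  set D := effDim n m Sig S
  set a := opNorm (pooledCov n m Sig S)
  obtain ⟨u, hu⟩ : ∃ u, u = -Real.log α + Real.log 60 := ⟨_, rfl⟩
  rw [← hu]
  have hu1 : 1 ≤ u := by
    have h1 : 1 ≤ Real.log 60 := by
      rw [Real.le_log_iff_exp_le (by norm_num)]
      linarith [Real.exp_one_lt_d9]
    linarith [Real.log_neg hα hα1]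
  have hexp : Real.exp (-u) = α / 60 := by
    rw [hu, neg_add, neg_neg, Real.exp_add, Real.exp_neg, Real.exp_log hα,
      Real.exp_log (by norm_num)]
    rfl
  have hDa : 0 < D * a ^ 2 := by
    rw [← htr]
    exact Finset.sum_pos' (fun i _ => sq_nonneg _) ⟨i₀, Finset.mem_univ _, by rw [hi₀]; positivity⟩
  have hD : 0 < D := pos_of_mul_pos_left hDa (sq_nonneg a)
  set δ := 16 * (σ * √u * max 1 (rateMin σ D u η)) with hδ
  have hq : 0 < σ * √u := by positivity
  have hδ1 : 16 * (σ * √u) ≤ δ := by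
    rw [hδ]
    exact mul_le_mul_of_nonneg_left (le_mul_of_one_le_right hq.le (le_max_left _ _)) (by norm_num)
  have hδ2 : 16 * (σ * √u * rateMin σ D u η) ≤ δ := by
    rw [hδ]
    gcongr
    exact le_max_right _ _
  have hq2 : (σ * √u) ^ 2 = a * u := by rw [mul_pow, hσ2, Real.sq_sqrt (by linarith)]
  -- Half of `(δ + 2η)δ` pays for the quadratic noise: through `δ²` if the minimum is `D^(1/4)`,
  -- through `ηδ` otherwise.
  have hmain : 16 * u * (a * √D) ≤ (δ + 2 * η) * (δ / 2) := by
    have hcase : 16 * (σ * √u * D ^ (1 / 4 : ℝ)) ≤ δ ∨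
        0 < η ∧ 16 * (σ * √u * (√(D * u) * (σ / η))) ≤ δ := by
      unfold rateMin at hδ2
      split_ifs at hδ2 with h0
      · exact Or.inl hδ2
      · rcases min_choice (D ^ (1 / 4 : ℝ)) (√(D * u) * (σ / η)) with h | h
        · exact Or.inl (by rwa [h] at hδ2)
        · exact Or.inr ⟨hη.lt_of_ne' h0, by rwa [h] at hδ2⟩
    have hδ0 : 0 ≤ δ := by linarith
    rcases hcase with h | ⟨h0, h⟩
    · have h2 := pow_le_pow_left₀ (by positivity) h 2
      have h3 : (16 * (σ * √u * D ^ (1 / 4 : ℝ))) ^ 2 = 256 * (a * u * √D) := by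
        rw [mul_pow, mul_pow, hq2, rpow_quarter_sq hD.le]; norm_num
      rw [h3] at h2
      have : 0 ≤ a * u * √D := by positivity
      nlinarith [mul_nonneg hη hδ0]
    · have h2 : 16 * (a * u * √D) ≤ η * δ := by
        refine le_trans (le_of_eq ?_) (mul_le_mul_of_nonneg_left h h0.le)
        rw [Real.sqrt_mul hD.le]
        have hsu : √u ^ 2 = u := Real.sq_sqrt (by linarith)
        rw [← hσ2]
        nth_rw 1 [← hsu]
        field_simp
      nlinarith [sq_nonneg δ]
  refine minSep_le_of_separated hn hm hSig hS he hs (by linarith) hsa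
    (F := a * √D) (by positivity) (by rw [htr, mul_pow, Real.sq_sqrt hD.le, mul_comm])
    (u := u) (by linarith) (by rw [hexp]; linarith) fun r hr => ?_
  -- As `√2 ≤ 3/2`, the linear noise is at most `3δ/16 ≤ δ/2`; the other half of `δ` absorbs it.
  have hsqrt : 2 * √(2 * a * u) ≤ 3 * (σ * √u) := by
    rw [← Real.sqrt_sq hq.le, hq2]
    have : √(2 * a * u) ≤ 3 / 2 * √(a * u) := by
      rw [Real.sqrt_le_left (by positivity), mul_pow, Real.sq_sqrt (by positivity)]
      nlinarith [mul_pos hpos (by linarith : 0 < u)]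
    linarith
  have h1 : (δ + 2 * η) * (δ / 2) ≤ (r + η) * (r - η - 2 * √(2 * a * u)) := by
    apply mul_le_mul <;> linarith
  nlinarith

end TwoSampleMean

open TwoSampleMean in
theorem theorem3 :
    -- upper bound, with a universal constant `C`
    (∃ C : ℝ, 0 < C ∧
      ∀ (d n m : ℕ) (_ : 1 ≤ n) (_ : 1 ≤ m) (Sig S : Matrix (Fin d) (Fin d) ℝ)
        (_ : Sig.PosSemidef) (_ : S.PosSemidef) (η α : ℝ) (_ : 0 ≤ η) (_ : 0 < α) (_ : α < 1),
        minSep n m α Sig S η ≤ ENNReal.ofReal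
          (C * (sigma n m Sig S * Real.sqrt (-Real.log α + Real.log 60) *
            max 1 (rateMin (sigma n m Sig S) (effDim n m Sig S)
              (-Real.log α + Real.log 60) η)))) ∧
    -- lower bounds
    (∀ (d n m : ℕ) (_ : 1 ≤ n) (_ : 1 ≤ m) (Sig S : Matrix (Fin d) (Fin d) ℝ)
        (_ : Sig.PosSemidef) (_ : S.PosSemidef) (η α : ℝ) (_ : 0 ≤ η) (_ : 0 < α) (_ : α < 1)
        (_ : 3 ≤ effDim n m Sig S),
        (α ≤ 99 / 100 →
          ENNReal.ofReal (sigma n m Sig S * Real.sqrt ((1 - α) / 48) *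
            max 1 (rateMin (sigma n m Sig S) (effDim n m Sig S) (1 - α) η))
            ≤ minSep n m α Sig S η) ∧
        ENNReal.ofReal (sigma n m Sig S * Real.sqrt ((1 - α) / 48) *
          max (Real.sqrt (1 - α))
            (rateMin (sigma n m Sig S) (effDim n m Sig S) (1 - α) η))
          ≤ minSep n m α Sig S η) := by
  refine ⟨⟨16, by norm_num, fun d n m hn hm Sig S hSig hS η α hη hα hα1 =>
    upper_bound hn hm hSig hS hη hα hα1⟩, fun d n m hn hm Sig S hSig hS η α hη hα hα1 hD =>
    ⟨fun hα99 => lower_bound hn hm hSig hS hη hα hα1 hD zero_le_one le_rfl ?_,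
      lower_bound hn hm hSig hS hη hα hα1 hD (Real.sqrt_nonneg _)
        (Real.sqrt_le_one.2 (by linarith)) ?_⟩⟩
  -- With `v = 1 - α` and `r = 1` the condition is `v/48 + (v/48)² < 3v²`, which fails for small
  -- `v`; `v ≥ 1/100` suffices.
  · nlinarith
  -- With `r² = v` the leading term is `v²/48`, so no lower bound on `v` is needed.
  · rw [Real.sq_sqrt (by linarith)]
    have : 0 < 1 - α := by linarith
    have h1 : (1 - α) * (1 - α) ≤ 1 := by nlinarith
    nlinarith [mul_pos this this]
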